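/- **Theorem 4.1.** Let $\alpha>1$, $\beta>0$, $\delta,\mu\in\mathbb R$, $\sigma>0$, put $\upsilon=\sigma^2$ and $\theta=(\alpha,\beta,\delta,\mu,\upsilon)$. Let $(X_i,Y_i)_{i\ge 1}$ be i.i.d. with the law $\mathrm{BGGL}(\alpha,\beta,\delta,\mu,\sigma)$ of $(X,\ \delta+\mu X+\sigma\sqrt X\,Z)$, where $X$ has the gamma density $\frac{\beta^\alpha}{\Gamma(\alpha)}x^{\alpha-1}e^{-\beta x}$ on $x>0$ and $Z\sim\mathcal N(0,1)$ is independent of $X$. Let $$f_\theta(x,y)=\frac{1}{\sqrt{2\pi\upsilon}}\frac{\beta^\alpha}{\Gamma(\alpha)}x^{\alpha-3/2}\exp\Big[-\Big(\beta x+\frac{(y-\delta-\mu x)^2}{2\upsilon x}\Big)\Big],\qquad x>0,\ y\in\mathbb R,$$ be the joint density, let $\mathcal I(\theta)=\mathrm{Cov}_\theta\big(\nabla_\theta\log f_\theta(X,Y)\big)$ be the Fisher information matrix, and let $\psi=(\log\Gamma)'$. A maximum likelihood estimate (MLE) for the sample $(X_1,Y_1),\dots,(X_n,Y_n)$ is a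 maximizer of $\theta'\mapsto\prod_{i=1}^n f_{\theta'}(X_i,Y_i)$ over $\{\theta'=(\alpha',\beta',\delta',\mu',\upsilon'):\alpha',\beta',\upsilon'>0\}$. Then the following hold. 1. The score $\nabla_\theta\log f_\theta(X,Y)$ is square integrable, and $\mathcal I(\theta)$ is positive definite and block-diagonal: $$\mathcal I(\theta)=\begin{bmatrix}\psi'(\alpha)&-1/\beta&0&0&0\\-1/\beta&\alpha/\beta^2&0&0&0\\0&0&\frac{\beta}{(\alpha-1)\sigma^2}&\frac1{\sigma^2}&0\\0&0&\frac1{\sigma^2}&\frac{\alpha}{\beta\sigma^2}&0\\0&0&0&0&\frac1{2\sigma^4}\end{bmatrix}.$$ 2. For every $n\ge3$, almost surely the MLE for the first $n$ observations exists and is unique, and it agrees almost surely with a measurable function of the sample. 3. Let $\hat\theta_n=(\hat\alpha_n,\hat\beta_n,\hat\delta_n,\hat\mu_n,\hat\upsilon_n)$ be any sequence of random vectors such that, for every $n\ge3$, $\hat\theta_n$ is almost surely an MLE for the first $n$ observations. Then, as $n\to\infty$, $$\sqrt n\,(\hat\theta_n-\theta)\xrightarrow{d}\mathcal N_5\big(0,\mathcal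 I(\theta)^{-1}\big).$$ 4. Consequently, $(\hat\alpha_n,\hat\beta_n)$, $(\hat\delta_n,\hat\mu_n)$ and $\hat\upsilon_n$ are asymptotically independent, that is, jointly $$\sqrt n\big((\hat\alpha_n-\alpha,\hat\beta_n-\beta),(\hat\delta_n-\delta,\hat\mu_n-\mu),\hat\upsilon_n-\upsilon\big)\xrightarrow{d}\mathcal N_2(0,\Sigma_{\alpha,\beta})\otimes\mathcal N_2(0,\Sigma_{\delta,\mu})\otimes\mathcal N(0,2\sigma^4),$$ where the limiting covariance matrices are positive definite and given by $$\Sigma_{\alpha,\beta}=\frac1{\alpha\psi'(\alpha)-1}\begin{bmatrix}\alpha&\beta\\\beta&\beta^2\psi'(\alpha)\end{bmatrix}=\begin{bmatrix}\psi'(\alpha)&-1/\beta\\-1/\beta&\alpha/\beta^2\end{bmatrix}^{-1},\qquad \Sigma_{\delta,\mu}=\frac{\sigma^2}{\beta}\begin{bmatrix}\alpha(\alpha-1)&-\beta(\alpha-1)\\-\beta(\alpha-1)&\beta^2\end{bmatrix}.$$ In particular, each of the three blocks, centred and multiplied by $\sqrt n$, converges in distribution to the corresponding Gaussian factor. -/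

import Mathlib

open MeasureTheory ProbabilityTheory Filter Topology

namespace BGGL

/-- The law of `(X, Y)` with `Y = δ + μ X + σ √X Z`, where `X` has the gamma distribution with
shape `α` and rate `β`, and `Z` is standard normal and independent of `X`. -/
noncomputable def law (α β δ μ σ : ℝ) : Measure (ℝ × ℝ) :=
  ((gammaMeasure α β).prod (gaussianReal 0 1)).map
    (fun p => (p.1, δ + μ * p.1 + σ * √p.1 * p.2))

/-- The parameter space of the vectors `θ = (α, β, δ, μ, υ)`, where `υ = σ ^ 2`. -/
def paramSpace : Set (EuclideanSpace ℝ (Fin 5)) :=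
  {θ | 0 < θ 0 ∧ 0 < θ 1 ∧ 0 < θ 4}

/-- The joint probability density function of `(X, Y)`, with `θ = (α, β, δ, μ, υ)`:
it is the gamma density of `X` times the normal density of `Y` given `X`. -/
noncomputable def pdf (θ : EuclideanSpace ℝ (Fin 5)) (z : ℝ × ℝ) : ℝ :=
  if 0 < z.1 then
    1 / √(2 * Real.pi) * (1 / √(θ 4)) * (θ 1 ^ θ 0 / Real.Gamma (θ 0)) * z.1 ^ (θ 0 - 3 / 2) *
      Real.exp (-(θ 1 * z.1 + (z.2 - θ 2 - θ 3 * z.1) ^ 2 / (2 * θ 4 * z.1)))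
  else 0

/-- The likelihood of the parameter `θ` for the sample `s`. -/
noncomputable def likelihood {n : ℕ} (s : Fin n → ℝ × ℝ) (θ : EuclideanSpace ℝ (Fin 5)) : ℝ :=
  ∏ i, pdf θ (s i)

/-- `θ` is a maximum likelihood estimate for the sample `s`. -/
def IsMLE {n : ℕ} (s : Fin n → ℝ × ℝ) (θ : EuclideanSpace ℝ (Fin 5)) : Prop :=
  θ ∈ paramSpace ∧ IsMaxOn (likelihood s) paramSpace θ

/-- The score: the gradient, with respect to the parameter, of the log-density. -/
noncomputable def score (θ : EuclideanSpace ℝ (Fin 5)) (z : ℝ × ℝ) : EuclideanSpace ℝ (Fin 5) :=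
  gradient (fun θ' => Real.log (pdf θ' z)) θ

/-- The Fisher information matrix: the covariance matrix of the score at `θ` when the
observation has parameter `θ`. -/
noncomputable def fisherInfo (θ : EuclideanSpace ℝ (Fin 5)) : Matrix (Fin 5) (Fin 5) ℝ :=
  Matrix.of fun i j =>
    cov[fun z => score θ z i, fun z => score θ z j; law (θ 0) (θ 1) (θ 2) (θ 3) (√(θ 4))]

/-- The digamma function `ψ = (log Γ)'`. -/
noncomputable def digamma : ℝ → ℝ := deriv (fun x => Real.log (Real.Gamma x))

/-- The trigamma function `ψ'`. -/
noncomputable def trigamma : ℝ → ℝ := deriv digamma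

/-- The Fisher information matrix of the gamma family. -/
noncomputable def gammaFisher (α β : ℝ) : Matrix (Fin 2) (Fin 2) ℝ :=
  !![trigamma α, -1 / β; -1 / β, α / β ^ 2]

/-- The limiting covariance matrix of the estimators of `α` and `β`. -/
noncomputable def covAlphaBeta (α β : ℝ) : Matrix (Fin 2) (Fin 2) ℝ :=
  (α * trigamma α - 1)⁻¹ • !![α, β; β, β ^ 2 * trigamma α]

/-- The limiting covariance matrix of the estimators of `δ` and `μ`. -/
noncomputable def covDeltaMu (α β σ : ℝ) : Matrix (Fin 2) (Fin 2) ℝ :=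
  (σ ^ 2 / β) • !![α * (α - 1), -β * (α - 1); -β * (α - 1), β ^ 2]

end BGGL

namespace BGGL

/-! ### The logarithm of a gamma variable -/

/-! The joint density is a gamma density in `x` times a normal density of `y` with mean `δ + μ x`
and variance `υ x`. The log-likelihood therefore splits into a gamma part in `(α, β)` and a weighted
least squares part in `(δ, μ, υ)`, and both can be maximized exactly.

Existence and uniqueness. For positive abscissae that are not all equal and points not all on one
line, the rate is shape over mean, the shape solves `log a - ψ(a) = log (mean x) - mean (log x)`,
`(δ, μ)` solves the normal equations with weights `1 / x`, and `υ` is the residual mean square.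
Strictness comes from `log u < u - 1` for `u ≠ 1`, from `log - ψ` being strictly decreasing
(equivalent in use to `ψ'(a) > 1 / a`), and from a positive definite quadratic form
(`Generic.likelihood_lt`). Three independent observations are almost surely in such position
(`generic_ae`).

Asymptotic normality. No Taylor expansion with remainder is needed: `Generic.mle_sub` is an exact
identity, error = `R_n` times the mean score, where the random matrix `R_n` is built from empirical
means, difference quotients and estimation errors. The strong law gives `R_n → I⁻¹` almost surely
(`tendsto_expansion`), the multivariate central limit theorem gives `√n` times the mean score a
limit `N(0, I)`, and Slutsky's theorem gives `N(0, I⁻¹ I I⁻¹) = N(0, I⁻¹)`. This inverse is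
block-diagonal, so the limit law is a product.

Information matrix. Substituting `Y = δ + μ X + σ √X Z` makes every score component a function of
`X` times a function of `Z`, so covariances are products of gamma and normal moments. The gamma ones
come from the moment generating function of `log X`, whose cumulants produce `ψ` and `ψ'`. -/

lemma gammaMeasure_ae_pos (a r : ℝ) : ∀ᵐ x ∂gammaMeasure a r, 0 < x := by
  rw [ae_iff]
  have : {x : ℝ | ¬ 0 < x} = Set.Iic 0 := by ext; simp
  rw [this, gammaMeasure, withDensity_apply _ measurableSet_Iic,
    ← setLIntegral_congr Iio_ae_eq_Iic, lintegral_gammaPDF_of_nonpos le_rfl]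

instance nullSingletonClass_gammaMeasure (a r : ℝ) : NullSingletonClass (gammaMeasure a r) := by
  unfold gammaMeasure
  infer_instance

lemma toReal_gammaPDF {a r : ℝ} (ha : 0 < a) (hr : 0 < r) (x : ℝ) :
    (gammaPDF a r x).toReal = gammaPDFReal a r x :=
  ENNReal.toReal_ofReal (gammaPDFReal_nonneg ha hr x)

lemma measurable_gammaPDF (a r : ℝ) : Measurable (gammaPDF a r) :=
  (measurable_gammaPDFReal a r).ennreal_ofReal

lemma gammaPDFReal_mul_exp_log {a r t x : ℝ} (hx : 0 < x) :
    gammaPDFReal a r x * Real.exp (t * Real.log x) =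
      r ^ a / Real.Gamma a * (x ^ (a + t - 1) * Real.exp (-(r * x))) := by
  rw [gammaPDFReal, if_pos hx.le, mul_comm t, ← Real.rpow_def_of_pos hx,
    show a + t - 1 = (a - 1) + t by ring, Real.rpow_add hx]
  ring

lemma integrable_gammaPDFReal_mul_exp_log {a r t : ℝ} (hr : 0 < r) (hat : 0 < a + t) :
    IntegrableOn (fun x => gammaPDFReal a r x * Real.exp (t * Real.log x)) (Set.Ioi 0) := by
  have h : IntegrableOn (fun x : ℝ => r ^ a / Real.Gamma a *
      (x ^ (a + t - 1) * Real.exp (-(r * x)))) (Set.Ioi 0) := by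
    have := integrableOn_rpow_mul_exp_neg_mul_rpow (p := 1) (s := a + t - 1) (b := r)
      (by linarith) one_pos hr
    simp only [Real.rpow_one, neg_mul] at this
    exact this.const_mul _
  exact h.congr_fun (fun x hx => (gammaPDFReal_mul_exp_log hx).symm) measurableSet_Ioi

lemma integral_gammaMeasure {a r : ℝ} (ha : 0 < a) (hr : 0 < r) (f : ℝ → ℝ) :
    ∫ x, f x ∂gammaMeasure a r = ∫ x in Set.Ioi 0, gammaPDFReal a r x * f x := by
  rw [gammaMeasure, integral_withDensity_eq_integral_toReal_smul (measurable_gammaPDF a r)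
    (ae_of_all _ fun x => ENNReal.ofReal_lt_top)]
  simp_rw [toReal_gammaPDF ha hr, smul_eq_mul]
  rw [← integral_Ici_eq_integral_Ioi, setIntegral_eq_integral_of_forall_compl_eq_zero]
  intro x hx
  rw [gammaPDFReal, if_neg (by simpa using hx), zero_mul]

lemma integrable_exp_mul_log_gammaMeasure {a r t : ℝ} (ha : 0 < a) (hr : 0 < r)
    (hat : 0 < a + t) :
    Integrable (fun x => Real.exp (t * Real.log x)) (gammaMeasure a r) := by
  rw [gammaMeasure, integrable_withDensity_iff_integrable_smul' (measurable_gammaPDF a r)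
    (ae_of_all _ fun x => ENNReal.ofReal_lt_top)]
  simp_rw [toReal_gammaPDF ha hr, smul_eq_mul]
  rw [← integrableOn_iff_integrable_of_support_subset (s := Set.Ici 0),
    integrableOn_Ici_iff_integrableOn_Ioi]
  · exact integrable_gammaPDFReal_mul_exp_log hr hat
  · intro x hx
    by_contra h
    exact hx (by simp [gammaPDFReal, if_neg (show ¬ (0 ≤ x) from h)])

/-- The integrand is `x ^ t` times the gamma density, an unnormalized gamma density of shape `a +
t`. All gamma moments below, including the logarithmic ones, are read off from this formula and its
derivatives. -/
lemma mgf_log_gammaMeasure {a r t : ℝ} (ha : 0 < a) (hr : 0 < r) (hat : 0 < a + t) :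
    mgf Real.log (gammaMeasure a r) t = Real.Gamma (a + t) / (Real.Gamma a * r ^ t) := by
  rw [mgf, integral_gammaMeasure ha hr,
    setIntegral_congr_fun measurableSet_Ioi (fun x hx => gammaPDFReal_mul_exp_log hx),
    integral_const_mul, Real.integral_rpow_mul_exp_neg_mul_Ioi hat hr, one_div,
    Real.inv_rpow hr.le, Real.rpow_add hr]
  have := Real.rpow_pos_of_pos hr a
  have := Real.rpow_pos_of_pos hr t
  have := Real.Gamma_pos_of_pos ha
  field_simp

lemma mem_interior_integrableExpSet_log {a r t : ℝ} (ha : 0 < a) (hr : 0 < r)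
    (hat : 0 < a + t) :
    t ∈ interior (integrableExpSet Real.log (gammaMeasure a r)) := by
  rw [mem_interior]
  refine ⟨Set.Ioi (-a), fun s hs => ?_, isOpen_Ioi, by simp only [Set.mem_Ioi]; linarith⟩
  exact integrable_exp_mul_log_gammaMeasure ha hr (by simp only [Set.mem_Ioi] at hs; linarith)

lemma cgf_log_gammaMeasure {a r t : ℝ} (ha : 0 < a) (hr : 0 < r) (hat : 0 < a + t) :
    cgf Real.log (gammaMeasure a r) t =
      Real.log (Real.Gamma (a + t)) - Real.log (Real.Gamma a) - t * Real.log r := by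
  have h1 := Real.Gamma_pos_of_pos ha
  have h2 := Real.Gamma_pos_of_pos hat
  have h3 := Real.rpow_pos_of_pos hr t
  rw [cgf, mgf_log_gammaMeasure ha hr hat, Real.log_div h2.ne' (by positivity),
    Real.log_mul h1.ne' h3.ne', Real.log_rpow hr]
  ring

/-! ### The digamma and trigamma functions -/

/-- For shape and rate one, the cumulant generating function of `log X` at `x - 1` is `log Γ(x)`,
and such functions are analytic inside their domain. -/
lemma analyticAt_log_Gamma {a : ℝ} (ha : 0 < a) :
    AnalyticAt ℝ (fun x => Real.log (Real.Gamma x)) a := by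
  have h := analyticAt_cgf (mem_interior_integrableExpSet_log (t := a - 1) one_pos one_pos
    (by linarith))
  have h2 : AnalyticAt ℝ (fun x : ℝ => cgf Real.log (gammaMeasure 1 1) (x - 1)) a :=
    h.fun_comp (f := fun x : ℝ => x - 1) (by fun_prop)
  refine h2.congr ?_
  filter_upwards [lt_mem_nhds ha] with x hx
  rw [cgf_log_gammaMeasure one_pos one_pos (by linarith)]
  simp

lemma hasDerivAt_log_Gamma {a : ℝ} (ha : 0 < a) :
    HasDerivAt (fun x => Real.log (Real.Gamma x)) (digamma a) a :=
  (analyticAt_log_Gamma ha).differentiableAt.hasDerivAt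

lemma hasDerivAt_digamma {a : ℝ} (ha : 0 < a) : HasDerivAt digamma (trigamma a) a :=
  (analyticAt_log_Gamma ha).deriv.differentiableAt.hasDerivAt

lemma digamma_add_one {a : ℝ} (ha : 0 < a) : digamma (a + 1) = digamma a + 1 / a := by
  have h1 : HasDerivAt (fun x => Real.log (Real.Gamma (x + 1))) (digamma (a + 1)) a :=
    (hasDerivAt_log_Gamma (a := a + 1) (by linarith)).comp_add_const a 1
  have h2 : HasDerivAt (fun x => Real.log (Real.Gamma x) + Real.log x)
      (digamma a + 1 / a) a := by
    rw [one_div]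
    exact (hasDerivAt_log_Gamma ha).add (Real.hasDerivAt_log ha.ne')
  refine h1.unique (h2.congr_of_eventuallyEq ?_)
  filter_upwards [lt_mem_nhds ha] with x hx
  rw [Real.Gamma_add_one hx.ne', Real.log_mul hx.ne' (Real.Gamma_pos_of_pos hx).ne', add_comm]

lemma trigamma_add_one {a : ℝ} (ha : 0 < a) : trigamma (a + 1) = trigamma a - 1 / a ^ 2 := by
  have h1 : HasDerivAt (fun x => digamma (x + 1)) (trigamma (a + 1)) a :=
    (hasDerivAt_digamma (a := a + 1) (by linarith)).comp_add_const a 1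
  have h2 : HasDerivAt (fun x => digamma x + x⁻¹) (trigamma a + -(a ^ 2)⁻¹) a :=
    (hasDerivAt_digamma ha).add (hasDerivAt_inv ha.ne')
  rw [h1.unique (h2.congr_of_eventuallyEq ?_)]
  · ring
  filter_upwards [lt_mem_nhds ha] with x hx
  rw [digamma_add_one hx, one_div]

lemma deriv_cgf_log_gammaMeasure {a r t : ℝ} (ha : 0 < a) (hr : 0 < r) (hat : 0 < a + t) :
    deriv (cgf Real.log (gammaMeasure a r)) t = digamma (a + t) - Real.log r := by
  have h1 : HasDerivAt (fun s => Real.log (Real.Gamma (a + s)) - Real.log (Real.Gamma a) -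
      s * Real.log r) (digamma (a + t) - 1 * Real.log r) t :=
    (((hasDerivAt_log_Gamma hat).comp_const_add a t).sub_const _).sub
      ((hasDerivAt_id t).mul_const _)
  rw [one_mul] at h1
  refine (h1.congr_of_eventuallyEq ?_).deriv
  filter_upwards [lt_mem_nhds (show -a < t by linarith)] with s hs
  exact cgf_log_gammaMeasure ha hr (by linarith)

lemma integral_log_gammaMeasure {a r : ℝ} (ha : 0 < a) (hr : 0 < r) :
    ∫ x, Real.log x ∂gammaMeasure a r = digamma a - Real.log r := by
  have := isProbabilityMeasure_gammaMeasure ha hr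
  have h := deriv_cgf_zero (mem_interior_integrableExpSet_log ha hr (t := 0) (by simpa))
  rw [deriv_cgf_log_gammaMeasure ha hr (by simpa)] at h
  simpa using h.symm

/-- The second derivative of the cumulant generating function at `t` is the variance under the law
tilted by `t`; at `t = 0` the tilt is trivial. -/
lemma variance_log_gammaMeasure {a r : ℝ} (ha : 0 < a) (hr : 0 < r) :
    Var[Real.log; gammaMeasure a r] = trigamma a := by
  have := isProbabilityMeasure_gammaMeasure ha hr
  have h := variance_tilted_mul (mem_interior_integrableExpSet_log ha hr (t := 0) (by simpa))
  simp only [zero_mul] at h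
  rw [tilted_const, iteratedDeriv_succ, iteratedDeriv_one] at h
  rw [h]
  have h1 : HasDerivAt (fun s => digamma (a + s) - Real.log r) (trigamma (a + 0)) 0 :=
    ((hasDerivAt_digamma (by simpa)).comp_const_add a 0).sub_const _
  rw [add_zero] at h1
  refine (h1.congr_of_eventuallyEq ?_).deriv
  filter_upwards [lt_mem_nhds (show -a < 0 by linarith)] with s hs
  exact deriv_cgf_log_gammaMeasure ha hr (by linarith)

lemma trigamma_nonneg {a : ℝ} (ha : 0 < a) : 0 ≤ trigamma a := by
  rw [← variance_log_gammaMeasure ha one_pos]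
  exact variance_nonneg _ _

/-- The gap `ψ'(b) - 1 / b` drops by `1 / (b² (b + 1)) > 0` when `b` becomes `b + 1`, and `ψ' ≥ 0`,
being a variance, bounds it below by `-1 / b`, which tends to `0`. Hence the gap is nonnegative at
`a + 1`, and one more strict step makes it positive at `a`. -/
lemma inv_lt_trigamma {a : ℝ} (ha : 0 < a) : 1 / a < trigamma a := by
  have step : ∀ b : ℝ, 0 < b → trigamma (b + 1) - 1 / (b + 1) < trigamma b - 1 / b := by
    intro b hb
    rw [trigamma_add_one hb]
    have : 0 < 1 / b ^ 2 - 1 / b + 1 / (b + 1) := by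
      have : 1 / b ^ 2 - 1 / b + 1 / (b + 1) = 1 / (b ^ 2 * (b + 1)) := by
        field_simp
        ring
      rw [this]
      positivity
    linarith
  have chain : ∀ k : ℕ, -(1 / (a + 1 + k)) ≤ trigamma (a + 1) - 1 / (a + 1) := by
    intro k
    have : trigamma (a + 1 + k) - 1 / (a + 1 + k) ≤ trigamma (a + 1) - 1 / (a + 1) := by
      induction k with
      | zero => simp
      | succ k ih =>
        have := step (a + 1 + k) (by positivity)
        push_cast
        rw [← add_assoc]
        exact this.le.trans ih
    have h2 := trigamma_nonneg (a := a + 1 + k) (by positivity)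
    linarith
  have lim : Tendsto (fun k : ℕ => -(1 / (a + 1 + (k : ℝ)))) atTop (𝓝 (-0)) :=
    ((tendsto_const_nhds (x := (1 : ℝ))).div_atTop
      (tendsto_atTop_add_const_left _ _ tendsto_natCast_atTop_atTop)).neg
  have h1 := le_of_tendsto' lim chain
  have h2 := step a ha
  linarith

/-! ### Bounds for `ψ` and the bijection `log - ψ` of the positive half-line. -/

lemma digamma_monotoneOn : MonotoneOn digamma (Set.Ioi 0) := by
  refine monotoneOn_of_deriv_nonneg (convex_Ioi 0)
    (fun x hx => (hasDerivAt_digamma hx).continuousAt.continuousWithinAt)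
    (fun x hx => ?_) (fun x hx => ?_) <;> rw [interior_Ioi] at hx
  · exact (hasDerivAt_digamma hx).differentiableAt.differentiableWithinAt
  · exact trigamma_nonneg hx

/-- Mean value theorem for `log Γ`, whose slope over `[a, a + 1]` is `log a` by the functional
equation. Monotonicity of `ψ` then traps `log a` between `ψ(a)` and `ψ(a + 1)`. -/
lemma exists_digamma_eq_log {a : ℝ} (ha : 0 < a) :
    ∃ c ∈ Set.Ioo a (a + 1), digamma c = Real.log a := by
  obtain ⟨c, hc, h⟩ := exists_hasDerivAt_eq_slope (fun x => Real.log (Real.Gamma x)) digamma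
    (show a < a + 1 by linarith)
    (fun x hx => (hasDerivAt_log_Gamma (ha.trans_le hx.1)).continuousAt.continuousWithinAt)
    (fun x hx => hasDerivAt_log_Gamma (ha.trans hx.1))
  refine ⟨c, hc, ?_⟩
  rw [h, Real.Gamma_add_one ha.ne', Real.log_mul ha.ne' (Real.Gamma_pos_of_pos ha).ne']
  ring

lemma digamma_le_log {a : ℝ} (ha : 0 < a) : digamma a ≤ Real.log a := by
  obtain ⟨c, hc, h⟩ := exists_digamma_eq_log ha
  rw [← h]
  exact digamma_monotoneOn ha (ha.trans hc.1) hc.1.le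

lemma log_le_digamma_add {a : ℝ} (ha : 0 < a) : Real.log a ≤ digamma a + 1 / a := by
  obtain ⟨c, hc, h⟩ := exists_digamma_eq_log ha
  rw [← h, ← digamma_add_one ha]
  exact digamma_monotoneOn (ha.trans hc.1) (show (0 : ℝ) < a + 1 by linarith) hc.2.le

/-- The function `a ↦ log a - ψ(a)`, whose inverse gives the shape estimate. -/
noncomputable def logSubDigamma (a : ℝ) : ℝ := Real.log a - digamma a

lemma hasDerivAt_logSubDigamma {a : ℝ} (ha : 0 < a) :
    HasDerivAt logSubDigamma (1 / a - trigamma a) a := by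
  rw [one_div]
  exact (Real.hasDerivAt_log ha.ne').sub (hasDerivAt_digamma ha)

lemma logSubDigamma_strictAntiOn : StrictAntiOn logSubDigamma (Set.Ioi 0) := by
  refine strictAntiOn_of_deriv_neg (convex_Ioi 0)
    (fun x hx => (hasDerivAt_logSubDigamma hx).continuousAt.continuousWithinAt)
    (fun x hx => ?_)
  rw [interior_Ioi] at hx
  rw [(hasDerivAt_logSubDigamma hx).deriv]
  linarith [inv_lt_trigamma hx]

lemma logSubDigamma_nonneg {a : ℝ} (ha : 0 < a) : 0 ≤ logSubDigamma a :=
  sub_nonneg.2 (digamma_le_log ha)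

lemma exists_logSubDigamma_eq {s : ℝ} (hs : 0 < s) : ∃ a, 0 < a ∧ logSubDigamma a = s := by
  -- The intermediate value theorem is applied between `1 / s` and `b = 1 / (2 s + 1)`. At `1 / s`
  -- the bound `log a - ψ(a) ≤ 1 / a` suffices. At `b`, `ψ(b) + 1 / b = ψ(b + 1) ≤ log (b + 1)`
  -- gives a value at least `2 s + 1 - log (2 (s + 1))`, hence at least `s + 1 - log 2 > s`.
  have hc : 0 < 2 * s + 1 := by linarith
  have hb : 0 < 1 / (2 * s + 1) := by positivity
  have hlow : s ≤ logSubDigamma (1 / (2 * s + 1)) := by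
    have h1 := digamma_le_log (a := 1 / (2 * s + 1) + 1) (by linarith)
    have h2 : 1 / (2 * s + 1) + 1 = (2 * (s + 1)) * (2 * s + 1)⁻¹ := by field_simp; ring
    rw [digamma_add_one hb, one_div_one_div, h2, Real.log_mul (by positivity) (by positivity),
      Real.log_mul (by norm_num) (by positivity)] at h1
    have h3 := Real.log_le_sub_one_of_pos (show 0 < s + 1 by linarith)
    have h4 := Real.log_two_lt_d9
    rw [logSubDigamma, one_div] at *
    linarith
  have hup : logSubDigamma (1 / s) ≤ s := by
    have := log_le_digamma_add (a := 1 / s) (by positivity)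
    rw [one_div_one_div] at this
    unfold logSubDigamma
    linarith
  obtain ⟨a, ha, h⟩ := isPreconnected_Ioi.intermediate_value (a := 1 / s) (b := 1 / (2 * s + 1))
    (s := Set.Ioi 0) (show (0 : ℝ) < 1 / s by positivity) hb
    (fun x hx => (hasDerivAt_logSubDigamma hx).continuousAt.continuousWithinAt)
    (show s ∈ Set.Icc _ _ from ⟨hup, hlow⟩)
  exact ⟨a, ha, h⟩

lemma logSubDigamma_pos {a : ℝ} (ha : 0 < a) : 0 < logSubDigamma a :=
  (logSubDigamma_nonneg (a := a + 1) (by linarith)).trans_lt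
    (logSubDigamma_strictAntiOn ha (show (0 : ℝ) < a + 1 by linarith) (by linarith))

/-! ### Moments of the standard normal law -/

lemma integrable_pow_gaussian (n : ℕ) : Integrable (fun z : ℝ => z ^ n) (gaussianReal 0 1) :=
  integrable_pow_of_mem_interior_integrableExpSet (X := id)
    (by rw [integrableExpSet_id_gaussianReal, interior_univ]; trivial) n

/-- Differentiating under the integral in `t` brings down one factor `z`, so the moments follow by
repeatedly differentiating `exp (t² / 2)` and setting `t = 0`. -/
lemma integral_pow_mul_exp_gaussian_succ {n : ℕ} {f f' : ℝ → ℝ}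
    (hf : ∀ t, ∫ z, z ^ n * Real.exp (t * z) ∂gaussianReal 0 1 = f t)
    (hf' : ∀ t, HasDerivAt f (f' t) t) (t : ℝ) :
    ∫ z, z ^ (n + 1) * Real.exp (t * z) ∂gaussianReal 0 1 = f' t := by
  have h := hasDerivAt_integral_pow_mul_exp_real (X := id) (μ := gaussianReal 0 1) (t := t)
    (by rw [integrableExpSet_id_gaussianReal, interior_univ]; trivial) n
  simp only [id] at h
  rw [funext hf] at h
  exact h.unique (hf' t)

lemma gaussian_moments :
    ∫ z, z ∂gaussianReal 0 1 = 0 ∧ ∫ z, z ^ 2 ∂gaussianReal 0 1 = 1 ∧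
      ∫ z, z ^ 3 ∂gaussianReal 0 1 = 0 ∧ ∫ z, z ^ 4 ∂gaussianReal 0 1 = 3 := by
  have e : ∀ t : ℝ, HasDerivAt (fun t : ℝ => Real.exp (t ^ 2 / 2)) (t * Real.exp (t ^ 2 / 2)) t := by
    intro t
    convert! (((hasDerivAt_id t).pow 2).div_const 2).exp using 1
    simp only [id, Pi.pow_apply]
    push_cast
    ring
  have h0 : ∀ t, ∫ z, z ^ 0 * Real.exp (t * z) ∂gaussianReal 0 1 = Real.exp (t ^ 2 / 2) := by
    intro t
    have := congrFun (mgf_id_gaussianReal (μ := 0) (v := 1)) t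
    simpa [mgf] using this
  have h1 := integral_pow_mul_exp_gaussian_succ h0 e
  have h2 := integral_pow_mul_exp_gaussian_succ (f' := fun t => (t ^ 2 + 1) * Real.exp (t ^ 2 / 2))
    h1 (fun t => by
      convert! (hasDerivAt_id t).mul (e t) using 1
      simp only [id]; ring)
  have h3 := integral_pow_mul_exp_gaussian_succ
    (f' := fun t => (t ^ 3 + 3 * t) * Real.exp (t ^ 2 / 2)) h2 (fun t => by
      convert! (((hasDerivAt_id t).pow 2).add_const 1).mul (e t) using 1
      simp only [id, Pi.pow_apply]; push_cast; ring)
  have h4 := integral_pow_mul_exp_gaussian_succ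
    (f' := fun t => (t ^ 4 + 6 * t ^ 2 + 3) * Real.exp (t ^ 2 / 2)) h3 (fun t => by
      convert! (((hasDerivAt_id t).pow 3).add ((hasDerivAt_id t).const_mul 3)).mul (e t) using 1
      simp only [id, Pi.pow_apply, Pi.add_apply]; push_cast; ring)
  refine ⟨?_, ?_, ?_, ?_⟩
  · simp
  · simpa using h2 0
  · simpa using h3 0
  · simpa using h4 0

/-! ### Moments of the gamma law -/

section gamma

variable {α β : ℝ}

lemma integral_id_gammaMeasure (hα : 0 < α) (hβ : 0 < β) :
    ∫ x, x ∂gammaMeasure α β = α / β := by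
  have h := mgf_log_gammaMeasure hα hβ (t := 1) (by linarith)
  rw [Real.Gamma_add_one hα.ne', Real.rpow_one, mgf] at h
  have hΓ := Real.Gamma_pos_of_pos hα
  rw [mul_comm α, mul_div_mul_left _ _ hΓ.ne'] at h
  rw [← h]
  refine integral_congr_ae ?_
  filter_upwards [gammaMeasure_ae_pos α β] with x hx
  rw [one_mul, Real.exp_log hx]

lemma integral_sq_gammaMeasure (hα : 0 < α) (hβ : 0 < β) :
    ∫ x, x ^ 2 ∂gammaMeasure α β = α * (α + 1) / β ^ 2 := by
  have h := mgf_log_gammaMeasure hα hβ (t := 2) (by linarith)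
  rw [show α + 2 = (α + 1) + 1 by ring, Real.Gamma_add_one (by linarith),
    Real.Gamma_add_one hα.ne', Real.rpow_two, mgf] at h
  have hΓ := Real.Gamma_pos_of_pos hα
  rw [show (α + 1) * (α * Real.Gamma α) = Real.Gamma α * (α * (α + 1)) by ring,
    mul_div_mul_left _ _ hΓ.ne'] at h
  rw [← h]
  refine integral_congr_ae ?_
  filter_upwards [gammaMeasure_ae_pos α β] with x hx
  rw [mul_comm, ← Real.rpow_def_of_pos hx, Real.rpow_two]

/-- The moment of order `-1` requires `α - 1 > 0`; this is where the restriction on the shape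
enters. -/
lemma integral_inv_gammaMeasure (hα : 1 < α) (hβ : 0 < β) :
    ∫ x, x⁻¹ ∂gammaMeasure α β = β / (α - 1) := by
  have h := mgf_log_gammaMeasure (show 0 < α by linarith) hβ (t := -1) (by linarith)
  have hΓ : Real.Gamma α = (α - 1) * Real.Gamma (α - 1) := by
    rw [← Real.Gamma_add_one (by linarith)]; ring_nf
  have hΓ' := Real.Gamma_pos_of_pos (show 0 < α - 1 by linarith)
  have h1 : 0 < α - 1 := by linarith
  rw [hΓ, ← sub_eq_add_neg, Real.rpow_neg_one, mgf] at h
  have h2 : Real.Gamma (α - 1) / ((α - 1) * Real.Gamma (α - 1) * β⁻¹) = β / (α - 1) := by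
    field_simp
  rw [← h2, ← h]
  refine integral_congr_ae ?_
  filter_upwards [gammaMeasure_ae_pos α β] with x hx
  rw [neg_one_mul, Real.exp_neg, Real.exp_log hx]

/-- The derivative of the cumulant generating function of `log X` at `1`, instead of `0`, is `E[X
log X] / E[X]`. -/
lemma integral_log_mul_id_gammaMeasure (hα : 0 < α) (hβ : 0 < β) :
    ∫ x, Real.log x * x ∂gammaMeasure α β =
      (digamma α + 1 / α - Real.log β) * (α / β) := by
  have h := deriv_cgf (mem_interior_integrableExpSet_log hα hβ (t := 1) (by linarith))
  rw [deriv_cgf_log_gammaMeasure hα hβ (by linarith), digamma_add_one hα] at h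
  have hmgf : mgf Real.log (gammaMeasure α β) 1 = α / β := by
    rw [mgf_log_gammaMeasure hα hβ (by linarith), Real.Gamma_add_one hα.ne', Real.rpow_one,
      mul_comm α, mul_div_mul_left _ _ (Real.Gamma_pos_of_pos hα).ne']
  rw [hmgf, eq_div_iff (by positivity)] at h
  rw [h]
  refine integral_congr_ae ?_
  filter_upwards [gammaMeasure_ae_pos α β] with x hx
  simp only [one_mul]
  rw [Real.exp_log hx]

lemma memLp_log_gammaMeasure (hα : 0 < α) (hβ : 0 < β) :
    MemLp Real.log 2 (gammaMeasure α β) :=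
  memLp_of_mem_interior_integrableExpSet
    (mem_interior_integrableExpSet_log hα hβ (t := 0) (by simpa)) 2

lemma memLp_id_gammaMeasure (hα : 0 < α) (hβ : 0 < β) :
    MemLp (fun x : ℝ => x) 2 (gammaMeasure α β) := by
  rw [memLp_two_iff_integrable_sq (by fun_prop)]
  refine (integrable_exp_mul_log_gammaMeasure hα hβ (t := 2) (by linarith)).congr ?_
  filter_upwards [gammaMeasure_ae_pos α β] with x hx
  rw [mul_comm, ← Real.rpow_def_of_pos hx, Real.rpow_two]

lemma integrable_inv_gammaMeasure (hα : 1 < α) (hβ : 0 < β) :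
    Integrable (fun x : ℝ => x⁻¹) (gammaMeasure α β) := by
  refine (integrable_exp_mul_log_gammaMeasure (by linarith) hβ (t := -1) (by linarith)).congr ?_
  filter_upwards [gammaMeasure_ae_pos α β] with x hx
  rw [neg_one_mul, Real.exp_neg, Real.exp_log hx]

lemma memLp_inv_sqrt_gammaMeasure (hα : 1 < α) (hβ : 0 < β) :
    MemLp (fun x : ℝ => (√x)⁻¹) 2 (gammaMeasure α β) := by
  rw [memLp_two_iff_integrable_sq (by fun_prop)]
  refine (integrable_inv_gammaMeasure hα hβ).congr ?_
  filter_upwards [gammaMeasure_ae_pos α β] with x hx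
  rw [inv_pow, Real.sq_sqrt hx.le]

lemma memLp_sqrt_gammaMeasure (hα : 0 < α) (hβ : 0 < β) :
    MemLp (fun x : ℝ => √x) 2 (gammaMeasure α β) := by
  have := isProbabilityMeasure_gammaMeasure hα hβ
  rw [memLp_two_iff_integrable_sq (by fun_prop)]
  refine ((memLp_id_gammaMeasure hα hβ).integrable (by norm_num)).congr ?_
  filter_upwards [gammaMeasure_ae_pos α β] with x hx
  rw [Real.sq_sqrt hx.le]

end gamma

/-! ### The score -/

/-- The components of the score on `0 < x`. -/
noncomputable def scoreFun (α β δ μ υ : ℝ) (z : ℝ × ℝ) : EuclideanSpace ℝ (Fin 5) :=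
  !₂[Real.log β - digamma α + Real.log z.1, α / β - z.1, (z.2 - δ - μ * z.1) / (υ * z.1),
    (z.2 - δ - μ * z.1) / υ, -(1 / (2 * υ)) + (z.2 - δ - μ * z.1) ^ 2 / (2 * υ ^ 2 * z.1)]

lemma log_pdf {θ : EuclideanSpace ℝ (Fin 5)} (hθ : θ ∈ paramSpace) {z : ℝ × ℝ} (hz : 0 < z.1) :
    Real.log (pdf θ z) = Real.log (1 / √(2 * Real.pi)) - Real.log (θ 4) / 2 +
      (θ 0 * Real.log (θ 1) - Real.log (Real.Gamma (θ 0))) + (θ 0 - 3 / 2) * Real.log z.1 -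
      (θ 1 * z.1 + (z.2 - θ 2 - θ 3 * z.1) ^ 2 / (2 * θ 4 * z.1)) := by
  obtain ⟨h0, h1, h4⟩ := hθ
  have hΓ := Real.Gamma_pos_of_pos h0
  have hp := Real.rpow_pos_of_pos h1 (θ 0)
  have hq := Real.rpow_pos_of_pos hz (θ 0 - 3 / 2)
  have hs := Real.sqrt_pos.2 h4
  have hpi := Real.pi_pos
  rw [pdf, if_pos hz, Real.log_mul (by positivity) (by positivity),
    Real.log_mul (by positivity) (by positivity), Real.log_mul (by positivity) (by positivity),
    Real.log_mul (by positivity) (by positivity), Real.log_div hp.ne' hΓ.ne', Real.log_rpow h1,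
    Real.log_rpow hz, Real.log_exp, one_div (√(θ 4)), Real.log_inv, Real.log_sqrt h4.le]
  ring

lemma isOpen_paramSpace : IsOpen paramSpace := by
  have h (i : Fin 5) : IsOpen {θ : EuclideanSpace ℝ (Fin 5) | 0 < θ i} :=
    isOpen_lt continuous_const (by fun_prop)
  exact (h 0).inter ((h 1).inter (h 4))

lemma score_eq {θ : EuclideanSpace ℝ (Fin 5)} (hθ : θ ∈ paramSpace) {z : ℝ × ℝ} (hz : 0 < z.1) :
    score θ z = scoreFun (θ 0) (θ 1) (θ 2) (θ 3) (θ 4) z := by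
  obtain ⟨h0, h1, h4⟩ := hθ
  have d (i : Fin 5) : HasFDerivAt (fun θ' : EuclideanSpace ℝ (Fin 5) => θ' i)
      (EuclideanSpace.proj i : EuclideanSpace ℝ (Fin 5) →L[ℝ] ℝ) θ :=
    (EuclideanSpace.proj i : EuclideanSpace ℝ (Fin 5) →L[ℝ] ℝ).hasFDerivAt
  have hlog4 := (Real.hasDerivAt_log h4.ne').comp_hasFDerivAt θ (d 4)
  have hlog1 := (Real.hasDerivAt_log h1.ne').comp_hasFDerivAt θ (d 1)
  have hG := (hasDerivAt_log_Gamma h0).comp_hasFDerivAt θ (d 0)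
  have hinv := (hasDerivAt_inv h4.ne').comp_hasFDerivAt θ (d 4)
  have hres := ((d 2).const_sub z.2).sub ((d 3).mul_const z.1)
  have hD := ((((hlog4.mul_const (1 / 2)).const_sub (Real.log (1 / √(2 * Real.pi)))).add
    (((d 0).mul hlog1).sub hG)).add (((d 0).sub_const (3 / 2)).mul_const (Real.log z.1))).sub
    (((d 1).mul_const z.1).add (((hres.pow 2).mul hinv).mul_const (2 * z.1)⁻¹))
  have hD' := hD.congr_of_eventuallyEq (f₁ := fun θ' => Real.log (pdf θ' z)) (by
    filter_upwards [isOpen_paramSpace.mem_nhds ⟨h0, h1, h4⟩] with θ' h'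
    rw [log_pdf h' hz]
    simp only [Function.comp_apply, Pi.add_apply, Pi.sub_apply, Pi.mul_apply,
      mul_inv, div_eq_mul_inv]
    ring)
  have key : ∀ v, inner ℝ (score θ z) v =
      inner ℝ (scoreFun (θ 0) (θ 1) (θ 2) (θ 3) (θ 4) z) v := by
    intro v
    rw [score, gradient, InnerProductSpace.toDual_symm_apply, hD'.fderiv]
    simp [PiLp.inner_apply, Fin.sum_univ_five, scoreFun]
    field_simp
    ring
  exact ext_inner_right ℝ key

/-! ### Integrals with respect to the law of `(X, Y)` -/

/-- The map sending `(X, Z)` to `(X, Y)`. -/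
noncomputable def lawMap (δ μ σ : ℝ) (p : ℝ × ℝ) : ℝ × ℝ := (p.1, δ + μ * p.1 + σ * √p.1 * p.2)

lemma measurable_lawMap (δ μ σ : ℝ) : Measurable (lawMap δ μ σ) := by
  unfold lawMap
  fun_prop

lemma law_eq_map (α β δ μ σ : ℝ) :
    law α β δ μ σ = ((gammaMeasure α β).prod (gaussianReal 0 1)).map (lawMap δ μ σ) := rfl

section law

variable {α β δ μ σ : ℝ}

lemma isProbabilityMeasure_law (hα : 0 < α) (hβ : 0 < β) (δ μ σ : ℝ) :
    IsProbabilityMeasure (law α β δ μ σ) := by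
  have := isProbabilityMeasure_gammaMeasure hα hβ
  rw [law_eq_map]
  exact Measure.isProbabilityMeasure_map (measurable_lawMap δ μ σ).aemeasurable

lemma gamma_prod_gaussian_ae_pos (hα : 0 < α) (hβ : 0 < β) :
    ∀ᵐ p ∂(gammaMeasure α β).prod (gaussianReal 0 1), 0 < p.1 := by
  have := isProbabilityMeasure_gammaMeasure hα hβ
  exact Measure.quasiMeasurePreserving_fst.ae (gammaMeasure_ae_pos α β)

lemma law_ae_pos (hα : 0 < α) (hβ : 0 < β) : ∀ᵐ z ∂law α β δ μ σ, 0 < z.1 := by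
  rw [law_eq_map, ae_map_iff (measurable_lawMap δ μ σ).aemeasurable
    (measurableSet_lt measurable_const measurable_fst)]
  exact gamma_prod_gaussian_ae_pos hα hβ

/-- A vertical section of a line has measure zero under the law. -/
lemma law_ae_ne_line (hα : 0 < α) (hβ : 0 < β) (hσ : 0 < σ) (a b : ℝ) :
    ∀ᵐ z ∂law α β δ μ σ, z.2 ≠ a + b * z.1 := by
  have := isProbabilityMeasure_gammaMeasure hα hβ
  have := nullSingletonClass_gaussianReal (μ := 0) (v := 1) one_ne_zero
  have hm : MeasurableSet {z : ℝ × ℝ | z.2 ≠ a + b * z.1} :=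
    (measurableSet_eq_fun measurable_snd (by fun_prop)).compl
  rw [law_eq_map, ae_map_iff (measurable_lawMap δ μ σ).aemeasurable hm]
  refine (Measure.ae_prod_iff_ae_ae (p := fun p => (lawMap δ μ σ p).2 ≠
    a + b * (lawMap δ μ σ p).1) (measurable_lawMap δ μ σ hm)).2 ?_
  filter_upwards [gammaMeasure_ae_pos α β] with x hx
  filter_upwards [(Set.countable_singleton ((a + b * x - δ - μ * x) / (σ * √x))).ae_notMem _]
    with z hz h
  refine hz ?_
  have := Real.sqrt_pos.2 hx
  simp only [lawMap] at h
  rw [Set.mem_singleton_iff, eq_div_iff (by positivity)]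
  linarith

/-- The vertical lines have measure zero under the law. -/
lemma law_ae_fst_ne (hα : 0 < α) (hβ : 0 < β) (a : ℝ) : ∀ᵐ z ∂law α β δ μ σ, z.1 ≠ a := by
  have := isProbabilityMeasure_gammaMeasure hα hβ
  have hm : MeasurableSet {z : ℝ × ℝ | z.1 ≠ a} :=
    (measurableSet_eq_fun measurable_fst measurable_const).compl
  rw [law_eq_map, ae_map_iff (measurable_lawMap δ μ σ).aemeasurable hm]
  exact Measure.quasiMeasurePreserving_fst.ae ((Set.countable_singleton a).ae_notMem _)

/-- The factors of the score components that depend on `X`. -/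
noncomputable def scoreGammaFactor (α β σ : ℝ) : Fin 5 → ℝ → ℝ :=
  ![fun x => Real.log β - digamma α + Real.log x, fun x => α / β - x, fun x => (√x)⁻¹ / σ,
    fun x => √x / σ, fun _ => 1 / (2 * σ ^ 2)]

/-- The factors of the score components that depend on `Z`. -/
noncomputable def scoreGaussianFactor : Fin 5 → ℝ → ℝ :=
  ![fun _ => 1, fun _ => 1, fun z => z, fun z => z, fun z => z ^ 2 - 1]

/-- The residual `Y - δ - μ X` is `σ √X Z`. Since `X` and `Z` are independent, every first or second
moment of the score becomes a gamma integral times a normal integral. -/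
lemma scoreFun_lawMap (hσ : 0 < σ) (i : Fin 5) {p : ℝ × ℝ} (hp : 0 < p.1) :
    scoreFun α β δ μ (σ ^ 2) (lawMap δ μ σ p) i =
      scoreGammaFactor α β σ i p.1 * scoreGaussianFactor i p.2 := by
  have h := Real.sqrt_pos.2 hp
  have h2 : p.1 = √p.1 ^ 2 := (Real.sq_sqrt hp.le).symm
  have e : δ + μ * p.1 + σ * √p.1 * p.2 - δ - μ * p.1 = σ * √p.1 * p.2 := by ring
  fin_cases i <;> simp [scoreFun, lawMap, scoreGammaFactor, scoreGaussianFactor]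
  · rw [e]
    nth_rewrite 2 [h2]
    field_simp
  · rw [e]
    field_simp
  · rw [e, mul_pow, mul_pow, ← h2]
    field_simp
    ring

lemma measurable_scoreFun (α β δ μ υ : ℝ) : Measurable (scoreFun α β δ μ υ) := by
  refine (MeasurableEquiv.toLp 2 (Fin 5 → ℝ)).measurable.comp (measurable_pi_lambda _ fun i => ?_)
  fin_cases i <;> simp <;> fun_prop

lemma memLp_scoreGammaFactor (hα : 1 < α) (hβ : 0 < β) (i : Fin 5) :
    MemLp (scoreGammaFactor α β σ i) 2 (gammaMeasure α β) := by
  have hα' : 0 < α := by linarith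
  have := isProbabilityMeasure_gammaMeasure hα' hβ
  fin_cases i
  · change MemLp (fun x => Real.log β - digamma α + Real.log x) 2 _
    exact MemLp.add (f := fun _ => Real.log β - digamma α) (memLp_const _)
      (memLp_log_gammaMeasure hα' hβ)
  · change MemLp (fun x => α / β - x) 2 _
    exact MemLp.sub (f := fun _ => α / β) (memLp_const _) (memLp_id_gammaMeasure hα' hβ)
  · simpa [scoreGammaFactor, div_eq_mul_inv] using
      (memLp_inv_sqrt_gammaMeasure hα hβ).mul_const σ⁻¹
  · simpa [scoreGammaFactor, div_eq_mul_inv] using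
      (memLp_sqrt_gammaMeasure hα' hβ).mul_const σ⁻¹
  · change MemLp (fun _ => 1 / (2 * σ ^ 2)) 2 _
    exact memLp_const _

lemma memLp_scoreGaussianFactor (i : Fin 5) :
    MemLp (scoreGaussianFactor i) 2 (gaussianReal 0 1) := by
  fin_cases i
  · change MemLp (fun _ => 1) 2 _
    exact memLp_const _
  · change MemLp (fun _ => 1) 2 _
    exact memLp_const _
  · exact memLp_id_gaussianReal' 2 (by simp)
  · exact memLp_id_gaussianReal' 2 (by simp)
  · change MemLp (fun z => z ^ 2 - 1) 2 _
    refine MemLp.sub ?_ (memLp_const _)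
    rw [memLp_two_iff_integrable_sq (by fun_prop)]
    simpa [← pow_mul] using integrable_pow_gaussian 4

lemma memLp_scoreFun (hα : 1 < α) (hβ : 0 < β) (hσ : 0 < σ) (i : Fin 5) :
    MemLp (fun z => scoreFun α β δ μ (σ ^ 2) z i) 2 (law α β δ μ σ) := by
  have hα' : 0 < α := by linarith
  have := isProbabilityMeasure_gammaMeasure hα' hβ
  have hm : Measurable (fun z => scoreFun α β δ μ (σ ^ 2) z i) := by
    have := measurable_scoreFun α β δ μ (σ ^ 2)
    fun_prop
  rw [law_eq_map, memLp_map_measure_iff hm.aestronglyMeasurable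
    (measurable_lawMap δ μ σ).aemeasurable,
    memLp_two_iff_integrable_sq (hm.comp (measurable_lawMap δ μ σ)).aestronglyMeasurable]
  refine ((memLp_scoreGammaFactor (σ := σ) hα hβ i).integrable_sq.mul_prod
    (memLp_scoreGaussianFactor i).integrable_sq).congr ?_
  filter_upwards [gamma_prod_gaussian_ae_pos hα' hβ] with p hp
  rw [Function.comp_apply, scoreFun_lawMap hσ i hp, mul_pow]

lemma integral_scoreFun (hα : 0 < α) (hβ : 0 < β) (hσ : 0 < σ) (i : Fin 5) :
    ∫ z, scoreFun α β δ μ (σ ^ 2) z i ∂law α β δ μ σ =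
      (∫ x, scoreGammaFactor α β σ i x ∂gammaMeasure α β) *
        ∫ z, scoreGaussianFactor i z ∂gaussianReal 0 1 := by
  have := isProbabilityMeasure_gammaMeasure hα hβ
  have hm : Measurable (fun z => scoreFun α β δ μ (σ ^ 2) z i) := by
    have := measurable_scoreFun α β δ μ (σ ^ 2)
    fun_prop
  rw [law_eq_map, integral_map (measurable_lawMap δ μ σ).aemeasurable hm.aestronglyMeasurable,
    ← integral_prod_mul]
  refine integral_congr_ae ?_
  filter_upwards [gamma_prod_gaussian_ae_pos hα hβ] with p hp
  rw [scoreFun_lawMap hσ i hp]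

lemma integral_scoreFun_mul (hα : 0 < α) (hβ : 0 < β) (hσ : 0 < σ) (i j : Fin 5) :
    ∫ z, scoreFun α β δ μ (σ ^ 2) z i * scoreFun α β δ μ (σ ^ 2) z j ∂law α β δ μ σ =
      (∫ x, scoreGammaFactor α β σ i x * scoreGammaFactor α β σ j x ∂gammaMeasure α β) *
        ∫ z, scoreGaussianFactor i z * scoreGaussianFactor j z ∂gaussianReal 0 1 := by
  have := isProbabilityMeasure_gammaMeasure hα hβ
  have hm : Measurable (fun z => scoreFun α β δ μ (σ ^ 2) z i *
      scoreFun α β δ μ (σ ^ 2) z j) := by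
    have := measurable_scoreFun α β δ μ (σ ^ 2)
    fun_prop
  rw [law_eq_map, integral_map (measurable_lawMap δ μ σ).aemeasurable hm.aestronglyMeasurable,
    ← integral_prod_mul]
  refine integral_congr_ae ?_
  filter_upwards [gamma_prod_gaussian_ae_pos hα hβ] with p hp
  rw [scoreFun_lawMap hσ i hp, scoreFun_lawMap hσ j hp]
  ring

lemma integral_scoreFun_eq_zero (hα : 1 < α) (hβ : 0 < β) (hσ : 0 < σ) (i : Fin 5) :
    ∫ z, scoreFun α β δ μ (σ ^ 2) z i ∂law α β δ μ σ = 0 := by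
  have hα' : 0 < α := by linarith
  have := isProbabilityMeasure_gammaMeasure hα' hβ
  obtain ⟨g1, g2, -, -⟩ := gaussian_moments
  rw [integral_scoreFun hα' hβ hσ]
  fin_cases i
  · simp only [scoreGammaFactor, Fin.zero_eta, Matrix.cons_val_zero]
    rw [integral_add (integrable_const _)
      ((memLp_log_gammaMeasure hα' hβ).integrable (by norm_num)),
      integral_log_gammaMeasure hα' hβ]
    simp
  · simp only [scoreGammaFactor, Fin.mk_one, Matrix.cons_val]
    rw [integral_sub (integrable_const _)
      ((memLp_id_gammaMeasure hα' hβ).integrable (by norm_num)),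
      integral_id_gammaMeasure hα' hβ]
    simp
  · simp [scoreGaussianFactor]
  · simp [scoreGaussianFactor]
  · simp only [scoreGaussianFactor, Fin.reduceFinMk, Matrix.cons_val]
    rw [integral_sub (integrable_pow_gaussian 2) (integrable_const _), g2]
    simp

/-- The closed form of the Fisher information matrix. -/
noncomputable def fisherMatrix (α β σ : ℝ) : Matrix (Fin 5) (Fin 5) ℝ :=
  !![trigamma α, -1 / β, 0, 0, 0;
    -1 / β, α / β ^ 2, 0, 0, 0;
    0, 0, β / ((α - 1) * σ ^ 2), 1 / σ ^ 2, 0;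
    0, 0, 1 / σ ^ 2, α / (β * σ ^ 2), 0;
    0, 0, 0, 0, 1 / (2 * σ ^ 4)]

lemma fisherMatrix_comm (i j : Fin 5) : fisherMatrix α β σ i j = fisherMatrix α β σ j i := by
  fin_cases i <;> fin_cases j <;> rfl

/-- The zero blocks are due to the normal factors alone: `E[Z]`, `E[Z² - 1]` and `E[Z (Z² - 1)]` all
vanish. -/
lemma integral_scoreFun_mul_eq (hα : 1 < α) (hβ : 0 < β) (hσ : 0 < σ) (i j : Fin 5) :
    ∫ z, scoreFun α β δ μ (σ ^ 2) z i * scoreFun α β δ μ (σ ^ 2) z j ∂law α β δ μ σ =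
      fisherMatrix α β σ i j := by
  wlog hij : i ≤ j
  · rw [fisherMatrix_comm, ← this (δ := δ) (μ := μ) hα hβ hσ j i (le_of_not_ge hij)]
    exact integral_congr_ae (ae_of_all _ fun z => mul_comm _ _)
  have hα' : 0 < α := by linarith
  have hα1 : 0 < α - 1 := by linarith
  have hP := isProbabilityMeasure_gammaMeasure hα' hβ
  have hlog := memLp_log_gammaMeasure hα' hβ
  have hid := memLp_id_gammaMeasure hα' hβ
  have ilog := hlog.integrable (by norm_num)
  have iid := hid.integrable (by norm_num)
  obtain ⟨g1, g2, g3, g4⟩ := gaussian_moments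
  have gz2 : ∫ z : ℝ, (z ^ 2 - 1) ∂gaussianReal 0 1 = 0 := by
    rw [integral_sub (integrable_pow_gaussian 2) (integrable_const _), g2]
    simp
  have gz3 : ∫ z : ℝ, z * (z ^ 2 - 1) ∂gaussianReal 0 1 = 0 := by
    have : ∀ z : ℝ, z * (z ^ 2 - 1) = z ^ 3 - z ^ 1 := fun z => by ring
    simp_rw [this]
    rw [integral_sub (integrable_pow_gaussian 3) (integrable_pow_gaussian 1), g3]
    simp
  have gz4 : ∫ z : ℝ, (z ^ 2 - 1) * (z ^ 2 - 1) ∂gaussianReal 0 1 = 2 := by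
    have : ∀ z : ℝ, (z ^ 2 - 1) * (z ^ 2 - 1) = z ^ 4 - 2 * z ^ 2 + 1 := fun z => by ring
    simp_rw [this]
    have i2 := (integrable_pow_gaussian 2).const_mul 2
    have i4 := integrable_pow_gaussian 4
    rw [integral_add (by exact i4.sub i2) (integrable_const _), integral_sub i4 i2,
      integral_const_mul, g4, g2]
    simp
    norm_num
  have gzz : ∫ z : ℝ, z * z ∂gaussianReal 0 1 = 1 := by simpa [sq] using g2
  have e00 : ∫ x, (Real.log β - digamma α + Real.log x) * (Real.log β - digamma α + Real.log x)
      ∂gammaMeasure α β = trigamma α := by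
    rw [← variance_log_gammaMeasure hα' hβ, variance_eq_integral hlog.aemeasurable,
      integral_log_gammaMeasure hα' hβ]
    refine integral_congr_ae (ae_of_all _ fun x => ?_)
    simp only
    ring
  have e01 : ∫ x, (Real.log β - digamma α + Real.log x) * (α / β - x)
      ∂gammaMeasure α β = -1 / β := by
    have : ∀ x : ℝ, (Real.log β - digamma α + Real.log x) * (α / β - x) =
      ((Real.log β - digamma α) * (α / β) - (Real.log β - digamma α) * x + (α / β) * Real.log x)
        - Real.log x * x := fun x => by ring
    simp_rw [this]
    rw [integral_sub, integral_add, integral_sub, integral_const_mul (α / β),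
      integral_const_mul _ (fun x => x), integral_const,
      integral_log_gammaMeasure hα' hβ, integral_id_gammaMeasure hα' hβ,
      integral_log_mul_id_gammaMeasure hα' hβ]
    · simp
      field_simp
      ring
    · exact integrable_const _
    · exact iid.const_mul _
    · exact (integrable_const _).sub (iid.const_mul _)
    · exact ilog.const_mul _
    · exact ((integrable_const _).sub (iid.const_mul _)).add (ilog.const_mul _)
    · exact hlog.integrable_mul hid
  have e11 : ∫ x, (α / β - x) * (α / β - x) ∂gammaMeasure α β = α / β ^ 2 := by
    have : ∀ x : ℝ, (α / β - x) * (α / β - x) = (α / β) ^ 2 - 2 * (α / β) * x + x ^ 2 :=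
      fun x => by ring
    simp_rw [this]
    rw [integral_add, integral_sub, integral_const_mul, integral_id_gammaMeasure hα' hβ,
      integral_sq_gammaMeasure hα' hβ]
    · simp
      field_simp
      ring
    · exact integrable_const _
    · exact iid.const_mul _
    · exact (integrable_const _).sub (iid.const_mul _)
    · exact hid.integrable_sq
  have e22 : ∫ x, (√x)⁻¹ / σ * ((√x)⁻¹ / σ) ∂gammaMeasure α β = β / ((α - 1) * σ ^ 2) := by
    have : ∫ x, (√x)⁻¹ / σ * ((√x)⁻¹ / σ) ∂gammaMeasure α β =
        ∫ x, (1 / σ ^ 2) * x⁻¹ ∂gammaMeasure α β := by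
      refine integral_congr_ae ?_
      filter_upwards [gammaMeasure_ae_pos α β] with x hx
      have := Real.sqrt_pos.2 hx
      nth_rewrite 3 [← Real.sq_sqrt hx.le]
      field_simp
    rw [this, integral_const_mul, integral_inv_gammaMeasure hα hβ]
    field_simp
  have e23 : ∫ x, (√x)⁻¹ / σ * (√x / σ) ∂gammaMeasure α β = 1 / σ ^ 2 := by
    have : ∫ x, (√x)⁻¹ / σ * (√x / σ) ∂gammaMeasure α β =
        ∫ x, (1 / σ ^ 2) ∂gammaMeasure α β := by
      refine integral_congr_ae ?_
      filter_upwards [gammaMeasure_ae_pos α β] with x hx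
      have := Real.sqrt_pos.2 hx
      field_simp
    rw [this]
    simp
  have e33 : ∫ x, √x / σ * (√x / σ) ∂gammaMeasure α β = α / (β * σ ^ 2) := by
    have : ∫ x, √x / σ * (√x / σ) ∂gammaMeasure α β =
        ∫ x, (1 / σ ^ 2) * x ∂gammaMeasure α β := by
      refine integral_congr_ae ?_
      filter_upwards [gammaMeasure_ae_pos α β] with x hx
      nth_rewrite 3 [← Real.sq_sqrt hx.le]
      field_simp
    rw [this, integral_const_mul, integral_id_gammaMeasure hα' hβ]
    field_simp
  rw [integral_scoreFun_mul hα' hβ hσ]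
  fin_cases i <;> fin_cases j <;>
    first
    | (exfalso; revert hij; decide)
    | simp [scoreGammaFactor, scoreGaussianFactor, fisherMatrix, e00, e01, e11, e22, e23, e33,
        gz2, gz3, gz4, gzz]
  field_simp

end law

/-! ### The Fisher information matrix -/

section fisher

variable {α β δ μ σ : ℝ}

lemma score_ae_eq (hα : 0 < α) (hβ : 0 < β) (hσ : 0 < σ) :
    score !₂[α, β, δ, μ, σ ^ 2] =ᵐ[law α β δ μ σ] scoreFun α β δ μ (σ ^ 2) := by
  filter_upwards [law_ae_pos hα hβ] with z hz
  exact score_eq (θ := !₂[α, β, δ, μ, σ ^ 2]) ⟨by simpa, by simpa, by simpa using pow_pos hσ 2⟩ hz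

lemma memLp_score (hα : 1 < α) (hβ : 0 < β) (hσ : 0 < σ) :
    MemLp (score !₂[α, β, δ, μ, σ ^ 2]) 2 (law α β δ μ σ) :=
  (MemLp.of_eval_piLp fun i => memLp_scoreFun hα hβ hσ i).ae_eq
    (score_ae_eq (by linarith) hβ hσ).symm

lemma fisherInfo_eq (hα : 1 < α) (hβ : 0 < β) (hσ : 0 < σ) :
    fisherInfo !₂[α, β, δ, μ, σ ^ 2] = fisherMatrix α β σ := by
  have hα' : 0 < α := by linarith
  have := isProbabilityMeasure_law hα' hβ δ μ σ
  have h := score_ae_eq (δ := δ) (μ := μ) hα' hβ hσ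
  have hi (i : Fin 5) : (fun z => score !₂[α, β, δ, μ, σ ^ 2] z i) =ᵐ[law α β δ μ σ]
      fun z => scoreFun α β δ μ (σ ^ 2) z i := by
    filter_upwards [h] with z hz
    rw [hz]
  ext i j
  have e : law (!₂[α, β, δ, μ, σ ^ 2] 0) (!₂[α, β, δ, μ, σ ^ 2] 1) (!₂[α, β, δ, μ, σ ^ 2] 2)
      (!₂[α, β, δ, μ, σ ^ 2] 3) √(!₂[α, β, δ, μ, σ ^ 2] 4) = law α β δ μ σ := by
    simp [Real.sqrt_sq hσ.le]
  rw [fisherInfo, Matrix.of_apply, e,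
    covariance_eq_sub ((memLp_score hα hβ hσ).eval_piLp i) ((memLp_score hα hβ hσ).eval_piLp j),
    integral_congr_ae ((hi i).mul (hi j)), integral_congr_ae (hi i),
    integral_scoreFun_eq_zero hα hβ hσ, zero_mul, sub_zero]
  exact integral_scoreFun_mul_eq hα hβ hσ i j

lemma quadratic_form_pos {a b d x y : ℝ} (ha : 0 < a) (h : 0 < a * d - b ^ 2)
    (hxy : x ≠ 0 ∨ y ≠ 0) : 0 < a * x ^ 2 + 2 * b * x * y + d * y ^ 2 := by
  have e : a * (a * x ^ 2 + 2 * b * x * y + d * y ^ 2) =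
      (a * x + b * y) ^ 2 + (a * d - b ^ 2) * y ^ 2 := by ring
  refine (mul_pos_iff_of_pos_left ha).1 ?_
  rw [e]
  by_cases hy : y = 0
  · have hx : x ≠ 0 := hxy.resolve_right (not_not.2 hy)
    subst hy
    simp only [mul_zero, add_zero, zero_pow two_ne_zero]
    positivity
  · positivity

lemma quadratic_form_nonneg {a b d : ℝ} (ha : 0 < a) (h : 0 < a * d - b ^ 2) (x y : ℝ) :
    0 ≤ a * x ^ 2 + 2 * b * x * y + d * y ^ 2 := by
  by_cases hxy : x ≠ 0 ∨ y ≠ 0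
  · exact (quadratic_form_pos ha h hxy).le
  · push Not at hxy
    simp [hxy.1, hxy.2]

lemma posDef_fin_two {a b d : ℝ} (ha : 0 < a) (h : 0 < a * d - b ^ 2) :
    (!![a, b; b, d] : Matrix (Fin 2) (Fin 2) ℝ).PosDef := by
  refine Matrix.PosDef.of_dotProduct_mulVec_pos ?_ fun x hx => ?_
  · ext i j
    fin_cases i <;> fin_cases j <;> simp
  · have hx' : x 0 ≠ 0 ∨ x 1 ≠ 0 := by
      by_contra! h0
      refine hx (funext fun i => ?_)
      fin_cases i
      · exact h0.1
      · exact h0.2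
    have := quadratic_form_pos ha h hx'
    simp only [dotProduct, Matrix.mulVec, Fin.sum_univ_two, star_trivial, Matrix.of_apply,
      Matrix.cons_val_zero, Matrix.cons_val_one, Matrix.cons_val_fin_one, Pi.star_apply]
    linarith

lemma mul_trigamma_sub_one_pos (hα : 0 < α) : 0 < α * trigamma α - 1 := by
  have := inv_lt_trigamma hα
  rw [div_lt_iff₀ hα] at this
  linarith

lemma trigamma_pos (hα : 0 < α) : 0 < trigamma α :=
  (one_div_pos.2 hα).trans (inv_lt_trigamma hα)

/-- The quadratic form is a sum of two binary forms and a square. The binary determinants are `(α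
ψ'(α) - 1) / β²`, positive because `ψ'(α) > 1 / α`, and `1 / ((α - 1) σ⁴)`. -/
lemma posDef_fisherMatrix (hα : 1 < α) (hβ : 0 < β) (hσ : 0 < σ) :
    (fisherMatrix α β σ).PosDef := by
  have hα' : 0 < α := by linarith
  have hα1 : 0 < α - 1 := by linarith
  have hD := mul_trigamma_sub_one_pos hα'
  have ht := trigamma_pos hα'
  have d1 : 0 < trigamma α * (α / β ^ 2) - (-1 / β) ^ 2 := by
    have : trigamma α * (α / β ^ 2) - (-1 / β) ^ 2 = (α * trigamma α - 1) / β ^ 2 := by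
      field_simp
    rw [this]
    positivity
  have p2 : 0 < β / ((α - 1) * σ ^ 2) := by positivity
  have d2 : 0 < β / ((α - 1) * σ ^ 2) * (α / (β * σ ^ 2)) - (1 / σ ^ 2) ^ 2 := by
    have : β / ((α - 1) * σ ^ 2) * (α / (β * σ ^ 2)) - (1 / σ ^ 2) ^ 2 =
        1 / ((α - 1) * σ ^ 4) := by
      field_simp
      ring
    rw [this]
    positivity
  have p3 : 0 < 1 / (2 * σ ^ 4) := by positivity
  refine Matrix.PosDef.of_dotProduct_mulVec_pos ?_ fun x hx => ?_
  · ext i j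
    simp [fisherMatrix_comm]
  · have e : star x ⬝ᵥ (fisherMatrix α β σ).mulVec x =
        (trigamma α * x 0 ^ 2 + 2 * (-1 / β) * x 0 * x 1 + α / β ^ 2 * x 1 ^ 2) +
        (β / ((α - 1) * σ ^ 2) * x 2 ^ 2 + 2 * (1 / σ ^ 2) * x 2 * x 3 +
          α / (β * σ ^ 2) * x 3 ^ 2) + 1 / (2 * σ ^ 4) * x 4 ^ 2 := by
      simp [dotProduct, Matrix.mulVec, Fin.sum_univ_five, fisherMatrix]
      ring
    rw [e]
    have n1 := quadratic_form_nonneg ht d1 (x 0) (x 1)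
    have n2 := quadratic_form_nonneg p2 d2 (x 2) (x 3)
    have n3 : 0 ≤ 1 / (2 * σ ^ 4) * x 4 ^ 2 := by positivity
    by_cases h1 : x 0 ≠ 0 ∨ x 1 ≠ 0
    · have := quadratic_form_pos ht d1 h1
      linarith
    by_cases h2 : x 2 ≠ 0 ∨ x 3 ≠ 0
    · have := quadratic_form_pos p2 d2 h2
      linarith
    have h3 : x 4 ≠ 0 := by
      intro h3
      push Not at h1 h2
      refine hx (funext fun i => ?_)
      fin_cases i
      exacts [h1.1, h1.2, h2.1, h2.2, h3]
    have : 0 < 1 / (2 * σ ^ 4) * x 4 ^ 2 := by positivity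
    linarith

lemma covAlphaBeta_eq_inv (hα : 0 < α) (hβ : 0 < β) :
    covAlphaBeta α β = (gammaFisher α β)⁻¹ := by
  have hD := mul_trigamma_sub_one_pos hα
  refine (Matrix.inv_eq_left_inv ?_).symm
  ext i j
  fin_cases i <;> fin_cases j <;>
    simp [covAlphaBeta, gammaFisher, Matrix.mul_apply, Fin.sum_univ_two] <;> field_simp <;> ring

lemma posDef_covAlphaBeta (hα : 0 < α) (hβ : 0 < β) : (covAlphaBeta α β).PosDef := by
  have hD := mul_trigamma_sub_one_pos hα
  refine Matrix.PosDef.smul (posDef_fin_two hα ?_) (inv_pos.2 hD)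
  have : α * (β ^ 2 * trigamma α) - β ^ 2 = β ^ 2 * (α * trigamma α - 1) := by ring
  rw [this]
  positivity

lemma posDef_covDeltaMu (hα : 1 < α) (hβ : 0 < β) (hσ : 0 < σ) :
    (covDeltaMu α β σ).PosDef := by
  have hα1 : 0 < α - 1 := by linarith
  refine Matrix.PosDef.smul (posDef_fin_two (by nlinarith) ?_) (by positivity)
  have : α * (α - 1) * β ^ 2 - (-β * (α - 1)) ^ 2 = (α - 1) * β ^ 2 := by ring
  rw [this]
  positivity

/-- The asymptotic covariance matrix of the maximum likelihood estimator. -/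
noncomputable def asymptoticCov (α β σ : ℝ) : Matrix (Fin 5) (Fin 5) ℝ :=
  !![covAlphaBeta α β 0 0, covAlphaBeta α β 0 1, 0, 0, 0;
    covAlphaBeta α β 1 0, covAlphaBeta α β 1 1, 0, 0, 0;
    0, 0, covDeltaMu α β σ 0 0, covDeltaMu α β σ 0 1, 0;
    0, 0, covDeltaMu α β σ 1 0, covDeltaMu α β σ 1 1, 0;
    0, 0, 0, 0, 2 * σ ^ 4]

lemma asymptoticCov_mul_fisherMatrix (hα : 1 < α) (hβ : 0 < β) (hσ : 0 < σ) :
    asymptoticCov α β σ * fisherMatrix α β σ = 1 := by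
  have hα' : 0 < α := by linarith
  have hα1 : 0 < α - 1 := by linarith
  have hD := mul_trigamma_sub_one_pos hα'
  ext i j
  fin_cases i <;> fin_cases j <;>
    simp [asymptoticCov, fisherMatrix, covAlphaBeta, covDeltaMu, Matrix.mul_apply,
      Fin.sum_univ_five] <;> field_simp <;> ring

lemma fisherMatrix_inv (hα : 1 < α) (hβ : 0 < β) (hσ : 0 < σ) :
    (fisherMatrix α β σ)⁻¹ = asymptoticCov α β σ :=
  Matrix.inv_eq_left_inv (asymptoticCov_mul_fisherMatrix hα hβ hσ)

lemma posSemidef_asymptoticCov (hα : 1 < α) (hβ : 0 < β) (hσ : 0 < σ) :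
    (asymptoticCov α β σ).PosSemidef := by
  rw [← fisherMatrix_inv hα hβ hσ]
  exact (posDef_fisherMatrix hα hβ hσ).inv.posSemidef

end fisher

/-! ### The multivariate central limit theorem -/

lemma charFun_map_eq_charFun_map_inner {Ω E : Type*} [MeasurableSpace Ω] {P : Measure Ω}
    [NormedAddCommGroup E] [InnerProductSpace ℝ E] [MeasurableSpace E] [BorelSpace E]
    [SecondCountableTopology E] {V : Ω → E} (hV : AEMeasurable V P) (t : E) :
    charFun (P.map V) t = charFun (P.map fun ω => inner ℝ (V ω) t) 1 := by
  rw [charFun_apply, charFun_apply, integral_map hV (by fun_prop),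
    integral_map (by fun_prop) (by fun_prop)]
  simp

/-- Cramér–Wold: by Lévy's continuity theorem it is enough to treat each characteristic function
value at `t`, which is the value at `1` for the scalar sums of `⟪W k, t⟫`. Their variance is `tᵀ S
t`, and the scalar central limit theorem applies. -/
theorem multivariate_central_limit {Ω ι : Type*} [MeasurableSpace Ω] [Fintype ι] [DecidableEq ι]
    {P : Measure Ω} [IsProbabilityMeasure P] {W : ℕ → Ω → EuclideanSpace ℝ ι}
    (hindep : iIndepFun W P) (hident : ∀ i, IdentDistrib (W i) (W 0) P P)
    (hmem : ∀ i, MemLp (fun ω => W 0 ω i) 2 P) (hmean : ∀ i, ∫ ω, W 0 ω i ∂P = 0)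
    {S : Matrix ι ι ℝ} (hS : S.PosSemidef) (hcov : ∀ i j, ∫ ω, W 0 ω i * W 0 ω j ∂P = S i j) :
    TendstoInDistribution (fun (n : ℕ) ω => (√(n : ℝ))⁻¹ • ∑ k ∈ Finset.range n, W k ω) atTop id
      (fun _ => P) (multivariateGaussian 0 S) := by
  have hm (k : ℕ) : AEMeasurable (W k) P := (hident k).aemeasurable_fst
  have hsum (n : ℕ) : AEMeasurable (fun ω => (√(n : ℝ))⁻¹ • ∑ k ∈ Finset.range n, W k ω) P :=
    AEMeasurable.fun_const_smul (Finset.aemeasurable_fun_sum _ fun k _ => hm k) _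
  refine ⟨hsum, aemeasurable_id, ?_⟩
  refine ProbabilityMeasure.tendsto_iff_tendsto_charFun.2 fun t => ?_
  set U : ℕ → Ω → ℝ := fun k ω => inner ℝ (W k ω) t with hU
  have hUeq (ω : Ω) : U 0 ω = ∑ i, t i * W 0 ω i := by
    simp [hU, PiLp.inner_apply]
  have hUmem : MemLp (U 0) 2 P := by
    simp_rw [funext hUeq]
    exact memLp_finsetSum _ fun i _ => (hmem i).const_mul _
  have hUmean : P[U 0] = 0 := by
    simp_rw [hUeq]
    rw [integral_finsetSum _ fun i _ => ((hmem i).integrable (by norm_num)).const_mul _]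
    simp [integral_const_mul, hmean]
  have hUvar : Var[U 0; P] = t ⬝ᵥ S.mulVec t := by
    rw [variance_of_integral_eq_zero hUmem.aemeasurable hUmean]
    simp_rw [hUeq, sq, Finset.sum_mul_sum]
    have hint (i j : ι) : Integrable (fun ω => t i * W 0 ω i * (t j * W 0 ω j)) P :=
      ((hmem i).const_mul (t i)).integrable_mul ((hmem j).const_mul (t j))
    rw [integral_finsetSum _ fun i _ => integrable_finsetSum _ fun j _ => hint i j]
    simp_rw [dotProduct, Matrix.mulVec, dotProduct, Finset.mul_sum]
    refine Finset.sum_congr rfl fun i _ => ?_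
    rw [integral_finsetSum _ fun j _ => hint i j]
    refine Finset.sum_congr rfl fun j _ => ?_
    rw [← hcov, ← integral_mul_const, ← integral_const_mul]
    refine integral_congr_ae (ae_of_all _ fun ω => ?_)
    simp only
    ring
  have hclt := tendstoInDistribution_inv_sqrt_mul_sum_sub (Y := id)
    (P' := gaussianReal 0 Var[U 0; P].toNNReal) (X := U) (P := P) ⟨aemeasurable_id, Measure.map_id⟩
    hUmem (hindep.comp (fun _ v => inner ℝ v t) (by fun_prop))
    (fun k => (hident k).comp (u := fun v => inner ℝ v t) (by fun_prop))
  have h1 := ProbabilityMeasure.tendsto_iff_tendsto_charFun.1 hclt.tendsto 1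
  simp only [ProbabilityMeasure.coe_mk, Measure.map_id, hUmean, mul_zero, sub_zero] at h1 ⊢
  rw [charFun_gaussianReal] at h1
  rw [charFun_multivariateGaussian hS, inner_zero_right]
  convert! h1 using 2 with n
  · rw [charFun_map_eq_charFun_map_inner (hsum n)]
    congr 2
    ext ω
    simp [hU, inner_smul_left, sum_inner]
  · rw [Real.coe_toNNReal _ (variance_nonneg _ _), hUvar]
    simp

/-! ### The maximum likelihood estimate -/

/-- The inverse of `logSubDigamma`, with the value `1` on nonpositive numbers. -/
noncomputable def shapeOf (s : ℝ) : ℝ :=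
  if h : 0 < s then (exists_logSubDigamma_eq h).choose else 1

lemma shapeOf_pos (s : ℝ) : 0 < shapeOf s := by
  unfold shapeOf
  split_ifs with h
  · exact (exists_logSubDigamma_eq h).choose_spec.1
  · exact one_pos

lemma logSubDigamma_shapeOf {s : ℝ} (hs : 0 < s) : logSubDigamma (shapeOf s) = s := by
  rw [shapeOf, dif_pos hs]
  exact (exists_logSubDigamma_eq hs).choose_spec.2

/-- The Galois-type relation of a decreasing inverse; both measurability and continuity of `shapeOf`
are deduced from it. -/
lemma shapeOf_le_iff {s c : ℝ} (hs : 0 < s) (hc : 0 < c) :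
    shapeOf s ≤ c ↔ logSubDigamma c ≤ s := by
  rw [← logSubDigamma_strictAntiOn.le_iff_ge hc (shapeOf_pos s), logSubDigamma_shapeOf hs]

lemma measurable_shapeOf : Measurable shapeOf := by
  refine measurable_of_Iic fun c => ?_
  by_cases hc : 0 < c
  -- On `s ≤ 0` the function has its default value `1`, so that half-line belongs to the preimage
  -- exactly when `1 ≤ c`.
  · have : shapeOf ⁻¹' Set.Iic c =
        (Set.Ioi 0 ∩ Set.Ici (logSubDigamma c)) ∪ (Set.Iic 0 ∩ {_s | 1 ≤ c}) := by
      ext s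
      rcases lt_or_ge 0 s with hs | hs
      · simp [shapeOf_le_iff hs hc, hs]
      · simp [shapeOf, hs, not_lt.2 hs]
    rw [this]
    exact (measurableSet_Ioi.inter measurableSet_Ici).union
      (measurableSet_Iic.inter (MeasurableSet.const _))
  · have : shapeOf ⁻¹' Set.Iic c = ∅ := by
      ext s
      have := shapeOf_pos s
      simp only [Set.mem_preimage, Set.mem_Iic, Set.mem_empty_iff_false, iff_false]
      linarith
    rw [this]
    exact MeasurableSet.empty

section sample

variable {n : ℕ}

/-- The empirical mean of `f` over a sample. -/
noncomputable def sampleMean (f : ℝ × ℝ → ℝ) (s : Fin n → ℝ × ℝ) : ℝ := (∑ i, f (s i)) / n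

lemma measurable_sampleMean {f : ℝ × ℝ → ℝ} (hf : Measurable f) :
    Measurable (sampleMean f : (Fin n → ℝ × ℝ) → ℝ) :=
  (Finset.measurable_fun_sum _ fun i _ => hf.comp (measurable_pi_apply i)).div_const _

/-- The empirical mean of `1 / x`. -/
noncomputable def meanInv (s : Fin n → ℝ × ℝ) : ℝ := sampleMean (fun z => z.1⁻¹) s

/-- The empirical mean of `x`. -/
noncomputable def meanFst (s : Fin n → ℝ × ℝ) : ℝ := sampleMean (fun z => z.1) s

/-- The empirical mean of `log x`. -/
noncomputable def meanLog (s : Fin n → ℝ × ℝ) : ℝ := sampleMean (fun z => Real.log z.1) s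

/-- The weighted residual mean square of the line `y = d + m x`. -/
noncomputable def resid (d m : ℝ) (s : Fin n → ℝ × ℝ) : ℝ :=
  sampleMean (fun z => (z.2 - d - m * z.1) ^ 2 / z.1) s

/-- The estimate of `δ`. -/
noncomputable def deltaHat (s : Fin n → ℝ × ℝ) : ℝ :=
  (meanFst s * sampleMean (fun z => z.2 / z.1) s - sampleMean (fun z => z.2) s) /
    (meanInv s * meanFst s - 1)

/-- The estimate of `μ`. -/
noncomputable def muHat (s : Fin n → ℝ × ℝ) : ℝ :=
  (meanInv s * sampleMean (fun z => z.2) s - sampleMean (fun z => z.2 / z.1) s) /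
    (meanInv s * meanFst s - 1)

/-- The estimate of `υ`. -/
noncomputable def upsilonHat (s : Fin n → ℝ × ℝ) : ℝ :=
  sampleMean (fun z => z.2 ^ 2 / z.1) s - deltaHat s * sampleMean (fun z => z.2 / z.1) s -
    muHat s * sampleMean (fun z => z.2) s

/-- The estimate of `α`. -/
noncomputable def alphaHat (s : Fin n → ℝ × ℝ) : ℝ :=
  shapeOf (Real.log (meanFst s) - meanLog s)

/-- The maximum likelihood estimate. -/
noncomputable def mle (s : Fin n → ℝ × ℝ) : EuclideanSpace ℝ (Fin 5) :=
  !₂[alphaHat s, alphaHat s / meanFst s, deltaHat s, muHat s, upsilonHat s]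

lemma measurable_mle : Measurable (mle : (Fin n → ℝ × ℝ) → EuclideanSpace ℝ (Fin 5)) := by
  have h1 : Measurable (meanInv : (Fin n → ℝ × ℝ) → ℝ) := measurable_sampleMean (by fun_prop)
  have h2 : Measurable (meanFst : (Fin n → ℝ × ℝ) → ℝ) := measurable_sampleMean (by fun_prop)
  have h3 : Measurable (meanLog : (Fin n → ℝ × ℝ) → ℝ) := measurable_sampleMean (by fun_prop)
  have h4 : Measurable (sampleMean (fun z => z.2 / z.1) : (Fin n → ℝ × ℝ) → ℝ) :=
    measurable_sampleMean (by fun_prop)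
  have h5 : Measurable (sampleMean (fun z => z.2) : (Fin n → ℝ × ℝ) → ℝ) :=
    measurable_sampleMean (by fun_prop)
  have h6 : Measurable (sampleMean (fun z => z.2 ^ 2 / z.1) : (Fin n → ℝ × ℝ) → ℝ) :=
    measurable_sampleMean (by fun_prop)
  have hd : Measurable (deltaHat : (Fin n → ℝ × ℝ) → ℝ) := by unfold deltaHat; fun_prop
  have hm : Measurable (muHat : (Fin n → ℝ × ℝ) → ℝ) := by unfold muHat; fun_prop
  have hu : Measurable (upsilonHat : (Fin n → ℝ × ℝ) → ℝ) := by unfold upsilonHat; fun_prop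
  have ha : Measurable (alphaHat : (Fin n → ℝ × ℝ) → ℝ) := by
    unfold alphaHat
    exact measurable_shapeOf.comp (by fun_prop)
  refine (MeasurableEquiv.toLp 2 (Fin 5 → ℝ)).measurable.comp (measurable_pi_lambda _ fun i => ?_)
  fin_cases i <;> simp <;> fun_prop

/-- A sample in general position: the likelihood of such a sample has a unique maximizer. -/
structure Generic (s : Fin n → ℝ × ℝ) : Prop where
  pos : ∀ i, 0 < (s i).1
  not_const : ∀ a, ∃ i, (s i).1 ≠ a
  not_line : ∀ d m, ∃ i, (s i).2 ≠ d + m * (s i).1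

/-! ### Consequences of general position. -/

lemma Generic.n_pos {s : Fin n → ℝ × ℝ} (hs : Generic s) : 0 < (n : ℝ) := by
  obtain ⟨i, -⟩ := hs.not_const 0
  exact_mod_cast i.pos

lemma resid_eq {s : Fin n → ℝ × ℝ} (hs : ∀ i, 0 < (s i).1) (hn : 0 < (n : ℝ)) (d m : ℝ) :
    resid d m s = sampleMean (fun z => z.2 ^ 2 / z.1) s
      - 2 * d * sampleMean (fun z => z.2 / z.1) s - 2 * m * sampleMean (fun z => z.2) s
      + d ^ 2 * meanInv s + 2 * d * m + m ^ 2 * meanFst s := by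
  have h : ∀ i, ((s i).2 - d - m * (s i).1) ^ 2 / (s i).1 =
      (s i).2 ^ 2 / (s i).1 - 2 * d * ((s i).2 / (s i).1) - 2 * m * (s i).2
        + d ^ 2 * (s i).1⁻¹ + 2 * d * m + m ^ 2 * (s i).1 := by
    intro i
    have := (hs i).ne'
    field_simp
    ring
  simp only [resid, sampleMean, meanInv, meanFst, h, Finset.sum_add_distrib,
    Finset.sum_sub_distrib, ← Finset.mul_sum, Finset.sum_const, Finset.card_univ,
    Fintype.card_fin, nsmul_eq_mul]
  field_simp

lemma Generic.meanFst_pos {s : Fin n → ℝ × ℝ} (hs : Generic s) : 0 < meanFst s := by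
  have : Nonempty (Fin n) := ⟨(hs.not_const 0).choose⟩
  exact div_pos (Finset.sum_pos (fun i _ => hs.pos i) Finset.univ_nonempty) hs.n_pos

/-- Strict Cauchy–Schwarz: with `B` the mean of `x`, the sum of `(x - B)² / x` is positive and
equals `n B` times the determinant of the normal equations. -/
lemma Generic.det_pos {s : Fin n → ℝ × ℝ} (hs : Generic s) :
    0 < meanInv s * meanFst s - 1 := by
  have hB := hs.meanFst_pos
  have hn := hs.n_pos
  set B := meanFst s with hBdef
  have hsum : 0 < ∑ i, ((s i).1 - B) ^ 2 / (s i).1 := by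
    obtain ⟨i, hi⟩ := hs.not_const B
    refine Finset.sum_pos' (fun j _ => div_nonneg (sq_nonneg _) (hs.pos j).le)
      ⟨i, Finset.mem_univ i, div_pos ?_ (hs.pos i)⟩
    have := sub_ne_zero.2 hi
    positivity
  have h : ∀ i, ((s i).1 - B) ^ 2 / (s i).1 = (s i).1 - 2 * B + B ^ 2 * (s i).1⁻¹ := by
    intro i
    have := (hs.pos i).ne'
    field_simp
    ring
  simp only [h, Finset.sum_add_distrib, Finset.sum_sub_distrib, ← Finset.mul_sum,
    Finset.sum_const, Finset.card_univ, Fintype.card_fin, nsmul_eq_mul] at hsum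
  have e1 : ∑ i, (s i).1 = n * B := by
    rw [hBdef, meanFst, sampleMean, mul_div_cancel₀ _ hn.ne']
  have e2 : ∑ i, (s i).1⁻¹ = n * meanInv s := by
    rw [meanInv, sampleMean, mul_div_cancel₀ _ hn.ne']
  rw [e1, e2] at hsum
  have : (n : ℝ) * B - 2 * (n * B) + B ^ 2 * (n * meanInv s) =
      (n * B) * (meanInv s * B - 1) := by ring
  rw [this] at hsum
  exact (mul_pos_iff_of_pos_left (by positivity)).1 hsum

/-- Strict Jensen inequality, from `log u ≤ u - 1` at `u = x / B`: the right-hand sides sum to zero.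
Positivity puts the gap in the range of `log - ψ`. -/
lemma Generic.log_gap_pos {s : Fin n → ℝ × ℝ} (hs : Generic s) :
    0 < Real.log (meanFst s) - meanLog s := by
  have hB := hs.meanFst_pos
  have hn := hs.n_pos
  set B := meanFst s with hBdef
  obtain ⟨i, hi⟩ := hs.not_const B
  have hlt : ∑ i, Real.log ((s i).1 / B) < ∑ i, ((s i).1 / B - 1) := by
    refine Finset.sum_lt_sum (fun j _ => Real.log_le_sub_one_of_pos (div_pos (hs.pos j) hB))
      ⟨i, Finset.mem_univ i, Real.log_lt_sub_one_of_pos (div_pos (hs.pos i) hB) ?_⟩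
    rwa [Ne, div_eq_one_iff_eq hB.ne']
  have h : ∀ i, Real.log ((s i).1 / B) = Real.log (s i).1 - Real.log B := fun i =>
    Real.log_div (hs.pos i).ne' hB.ne'
  simp only [h, Finset.sum_sub_distrib, ← Finset.sum_div,
    Finset.sum_const, Finset.card_univ, Fintype.card_fin, nsmul_eq_mul] at hlt
  have e1 : ∑ i, (s i).1 = n * B := by
    rw [hBdef, meanFst, sampleMean, mul_div_cancel₀ _ hn.ne']
  have e2 : ∑ i, Real.log (s i).1 = n * meanLog s := by
    rw [meanLog, sampleMean, mul_div_cancel₀ _ hn.ne']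
  rw [e1, e2, mul_div_cancel_right₀ _ hB.ne'] at hlt
  have : 0 < (n : ℝ) * (Real.log B - meanLog s) := by linarith
  exact (mul_pos_iff_of_pos_left hn).1 this

/-- Cramer's rule for least squares with weights `1 / x`; the off-diagonal coefficient is the mean
of `x · (1 / x) = 1`. -/
lemma normal_equations {s : Fin n → ℝ × ℝ} (hs : meanInv s * meanFst s - 1 ≠ 0) :
    meanInv s * deltaHat s + muHat s = sampleMean (fun z => z.2 / z.1) s ∧
      deltaHat s + meanFst s * muHat s = sampleMean (fun z => z.2) s := by
  constructor <;>
  · rw [deltaHat, muHat, ← mul_div_assoc, ← add_div, div_eq_iff hs]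
    ring

/-- Completing the square at the least squares solution: the normal equations remove the linear
terms. -/
lemma Generic.resid_eq {s : Fin n → ℝ × ℝ} (hs : Generic s) (d m : ℝ) :
    resid d m s = upsilonHat s + (meanInv s * (d - deltaHat s) ^ 2 +
      2 * 1 * (d - deltaHat s) * (m - muHat s) + meanFst s * (m - muHat s) ^ 2) := by
  obtain ⟨h1, h2⟩ := normal_equations hs.det_pos.ne'
  rw [BGGL.resid_eq hs.pos hs.n_pos, upsilonHat, ← h1, ← h2]
  ring

lemma Generic.upsilonHat_eq {s : Fin n → ℝ × ℝ} (hs : Generic s) :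
    upsilonHat s = resid (deltaHat s) (muHat s) s := by
  rw [hs.resid_eq]
  ring

lemma Generic.upsilonHat_pos {s : Fin n → ℝ × ℝ} (hs : Generic s) : 0 < upsilonHat s := by
  rw [hs.upsilonHat_eq]
  obtain ⟨i, hi⟩ := hs.not_line (deltaHat s) (muHat s)
  refine div_pos (Finset.sum_pos' (fun j _ => div_nonneg (sq_nonneg _) (hs.pos j).le)
      ⟨i, Finset.mem_univ i, div_pos ?_ (hs.pos i)⟩) hs.n_pos
  have : (s i).2 - deltaHat s - muHat s * (s i).1 ≠ 0 := by
    intro h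
    exact hi (by linarith)
  positivity

lemma Generic.meanInv_pos {s : Fin n → ℝ × ℝ} (hs : Generic s) : 0 < meanInv s := by
  have h := hs.det_pos
  have hB := hs.meanFst_pos
  by_contra! h0
  nlinarith

lemma Generic.mle_mem {s : Fin n → ℝ × ℝ} (hs : Generic s) : mle s ∈ paramSpace :=
  ⟨shapeOf_pos _, div_pos (shapeOf_pos _) hs.meanFst_pos, hs.upsilonHat_pos⟩

/-- The part of the mean log-likelihood that depends on the gamma parameters. -/
noncomputable def gammaLogLik (s : Fin n → ℝ × ℝ) (a b : ℝ) : ℝ :=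
  a * Real.log b - Real.log (Real.Gamma a) + (a - 3 / 2) * meanLog s - b * meanFst s

/-! ### Splitting and strict maximization of the log-likelihood. -/

lemma log_likelihood {s : Fin n → ℝ × ℝ} (hs : Generic s) {θ : EuclideanSpace ℝ (Fin 5)}
    (hθ : θ ∈ paramSpace) :
    Real.log (likelihood s θ) = n * (Real.log (1 / √(2 * Real.pi)) +
      gammaLogLik s (θ 0) (θ 1) + (-(Real.log (θ 4)) / 2 - resid (θ 2) (θ 3) s / (2 * θ 4))) := by
  have hn := hs.n_pos
  have h4 := hθ.2.2
  have hpos : ∀ i, pdf θ (s i) ≠ 0 := by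
    intro i
    have h1 := Real.Gamma_pos_of_pos hθ.1
    have h2 := Real.rpow_pos_of_pos hθ.2.1 (θ 0)
    have h3 := Real.rpow_pos_of_pos (hs.pos i) (θ 0 - 3 / 2)
    have := Real.sqrt_pos.2 h4
    have := Real.pi_pos
    rw [pdf, if_pos (hs.pos i)]
    positivity
  have e : ∀ i, Real.log (pdf θ (s i)) = Real.log (1 / √(2 * Real.pi)) - Real.log (θ 4) / 2 +
      (θ 0 * Real.log (θ 1) - Real.log (Real.Gamma (θ 0))) + (θ 0 - 3 / 2) * Real.log (s i).1 -
      (θ 1 * (s i).1 + ((s i).2 - θ 2 - θ 3 * (s i).1) ^ 2 / (s i).1 * (1 / (2 * θ 4))) := by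
    intro i
    have := (hs.pos i).ne'
    rw [log_pdf hθ (hs.pos i)]
    congr 2
    field_simp
  rw [likelihood, Real.log_prod fun i _ => hpos i]
  simp only [e, gammaLogLik, resid, sampleMean, meanLog, meanFst, Finset.sum_add_distrib,
    Finset.sum_sub_distrib, ← Finset.mul_sum, ← Finset.sum_mul, Finset.sum_const,
    Finset.card_univ, Fintype.card_fin, nsmul_eq_mul]
  field_simp
  ring

lemma likelihood_pos {s : Fin n → ℝ × ℝ} (hs : ∀ i, 0 < (s i).1)
    {θ : EuclideanSpace ℝ (Fin 5)} (hθ : θ ∈ paramSpace) : 0 < likelihood s θ := by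
  refine Finset.prod_pos fun i _ => ?_
  have h1 := Real.Gamma_pos_of_pos hθ.1
  have h2 := Real.rpow_pos_of_pos hθ.2.1 (θ 0)
  have h3 := Real.rpow_pos_of_pos (hs i) (θ 0 - 3 / 2)
  have := Real.sqrt_pos.2 hθ.2.2
  have := Real.pi_pos
  rw [pdf, if_pos (hs i)]
  positivity

/-- This is the gamma log-likelihood in the shape once the rate is optimized. Its derivative `log a
- ψ(a) - t` is strictly decreasing and vanishes at `a₀`, so the mean value theorem gives a strict
inequality on either side. -/
lemma gamma_profile_lt {a a₀ t : ℝ} (ha : 0 < a) (ha₀ : 0 < a₀) (h : logSubDigamma a₀ = t)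
    (hne : a ≠ a₀) :
    a * Real.log a - a - Real.log (Real.Gamma a) - t * a <
      a₀ * Real.log a₀ - a₀ - Real.log (Real.Gamma a₀) - t * a₀ := by
  have hd : ∀ x : ℝ, 0 < x → HasDerivAt
      (fun x => x * Real.log x - x - Real.log (Real.Gamma x) - t * x) (logSubDigamma x - t) x := by
    intro x hx
    convert! ((((hasDerivAt_id x).mul (Real.hasDerivAt_log hx.ne')).sub (hasDerivAt_id x)).sub
      (hasDerivAt_log_Gamma hx)).sub ((hasDerivAt_id x).const_mul t) using 1
    simp only [id, logSubDigamma]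
    field_simp
    ring
  rcases lt_or_gt_of_ne hne with hlt | hlt
  · obtain ⟨c, hc, he⟩ := exists_hasDerivAt_eq_slope _ _ hlt
      (fun x hx => (hd x (ha.trans_le hx.1)).continuousAt.continuousWithinAt)
      (fun x hx => hd x (ha.trans hx.1))
    have hc' := logSubDigamma_strictAntiOn (ha.trans hc.1) ha₀ hc.2
    have hpos : 0 < logSubDigamma c - t := by linarith
    rw [he, lt_div_iff₀ (by linarith), zero_mul] at hpos
    linarith
  · obtain ⟨c, hc, he⟩ := exists_hasDerivAt_eq_slope _ _ hlt
      (fun x hx => (hd x (ha₀.trans_le hx.1)).continuousAt.continuousWithinAt)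
      (fun x hx => hd x (ha₀.trans hx.1))
    have hc' := logSubDigamma_strictAntiOn ha₀ (ha₀.trans hc.1) hc.1
    have hneg : logSubDigamma c - t < 0 := by linarith
    rw [he, div_lt_iff₀ (by linarith), zero_mul] at hneg
    linarith

/-- The inequality `log u ≤ u - 1` at `u = b B / a`, strict unless `u = 1`. -/
lemma gamma_rate_le {a b B : ℝ} (ha : 0 < a) (hb : 0 < b) (hB : 0 < B) :
    a * Real.log b - b * B ≤ a * Real.log (a / B) - a ∧
      (b ≠ a / B → a * Real.log b - b * B < a * Real.log (a / B) - a) := by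
  have e : Real.log b - Real.log (a / B) = Real.log (b * B / a) := by
    rw [Real.log_div ha.ne' hB.ne', Real.log_div (by positivity) ha.ne',
      Real.log_mul hb.ne' hB.ne']
    ring
  have e2 : a * (b * B / a - 1) = b * B - a := by field_simp
  constructor
  · have := mul_le_mul_of_nonneg_left
      (Real.log_le_sub_one_of_pos (show 0 < b * B / a by positivity)) ha.le
    rw [← e, e2] at this
    linarith
  · intro hne
    have hne' : b * B / a ≠ 1 := by
      rw [Ne, div_eq_one_iff_eq ha.ne']
      intro h
      exact hne (by rw [← h]; field_simp)
    have := mul_lt_mul_of_pos_left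
      (Real.log_lt_sub_one_of_pos (show 0 < b * B / a by positivity) hne') ha
    rw [← e, e2] at this
    linarith

lemma Generic.gammaLogLik_lt {s : Fin n → ℝ × ℝ} (hs : Generic s) {a b : ℝ} (ha : 0 < a)
    (hb : 0 < b) (hne : ¬ (a = alphaHat s ∧ b = alphaHat s / meanFst s)) :
    gammaLogLik s a b < gammaLogLik s (alphaHat s) (alphaHat s / meanFst s) := by
  have hB := hs.meanFst_pos
  have ha₀ : 0 < alphaHat s := shapeOf_pos _
  have hh : logSubDigamma (alphaHat s) = Real.log (meanFst s) - meanLog s :=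
    logSubDigamma_shapeOf hs.log_gap_pos
  obtain ⟨h1, h2⟩ := gamma_rate_le ha hb hB
  have e : gammaLogLik s (alphaHat s) (alphaHat s / meanFst s) = alphaHat s *
      Real.log (alphaHat s) - alphaHat s - Real.log (Real.Gamma (alphaHat s)) -
      (Real.log (meanFst s) - meanLog s) * alphaHat s - 3 / 2 * meanLog s := by
    rw [gammaLogLik, Real.log_div ha₀.ne' hB.ne']
    field_simp
    ring
  rw [Real.log_div ha.ne' hB.ne'] at h1 h2
  rw [e, gammaLogLik]
  by_cases haeq : a = alphaHat s
  · have hbne : b ≠ a / meanFst s := fun hb' => hne ⟨haeq, by rw [hb', haeq]⟩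
    have := h2 hbne
    rw [← haeq]
    linarith
  · have := gamma_profile_lt ha ha₀ hh haeq
    linarith

/-- Again `log u ≤ u - 1`, at `u = q₀ / v`, combined with `q₀ / v ≤ q / v`; equality forces both `v
= q₀` and `q = q₀`. -/
lemma normal_profile_le {v q q₀ : ℝ} (hv : 0 < v) (hq₀ : 0 < q₀) (hq : q₀ ≤ q) :
    -(Real.log v) / 2 - q / (2 * v) ≤ -(Real.log q₀) / 2 - q₀ / (2 * q₀) ∧
      (¬ (v = q₀ ∧ q = q₀) →
        -(Real.log v) / 2 - q / (2 * v) < -(Real.log q₀) / 2 - q₀ / (2 * q₀)) := by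
  have e : Real.log q₀ - Real.log v = Real.log (q₀ / v) :=
    (Real.log_div hq₀.ne' hv.ne').symm
  have h1 : q₀ / (2 * q₀) = 1 / 2 := by field_simp
  have h2 : q / (2 * v) = (q / v) / 2 := by field_simp
  have h3 : q₀ / v ≤ q / v := by gcongr
  have h4 := Real.log_le_sub_one_of_pos (show 0 < q₀ / v by positivity)
  rw [h1, h2]
  refine ⟨by linarith, fun hne => ?_⟩
  by_cases hvq : v = q₀
  · have : q₀ / v < q / v := by
      have : q₀ < q := lt_of_le_of_ne hq fun h => hne ⟨hvq, h.symm⟩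
      gcongr
    linarith
  · have := Real.log_lt_sub_one_of_pos (show 0 < q₀ / v by positivity) (by
      rw [Ne, div_eq_one_iff_eq hv.ne']
      exact fun h => hvq h.symm)
    linarith

lemma Generic.likelihood_lt {s : Fin n → ℝ × ℝ} (hs : Generic s)
    {θ : EuclideanSpace ℝ (Fin 5)} (hθ : θ ∈ paramSpace) (hne : θ ≠ mle s) :
    likelihood s θ < likelihood s (mle s) := by
  rw [← Real.log_lt_log_iff (likelihood_pos hs.pos hθ) (likelihood_pos hs.pos hs.mle_mem),
    log_likelihood hs hθ, log_likelihood hs hs.mle_mem]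
  refine mul_lt_mul_of_pos_left ?_ hs.n_pos
  have hA := hs.meanInv_pos
  have hdet : 0 < meanInv s * meanFst s - 1 ^ 2 := by
    have := hs.det_pos
    linarith
  have e : mle s 0 = alphaHat s ∧ mle s 1 = alphaHat s / meanFst s ∧ mle s 2 = deltaHat s ∧
      mle s 3 = muHat s ∧ mle s 4 = upsilonHat s := ⟨rfl, rfl, rfl, rfl, rfl⟩
  obtain ⟨e0, e1, e2, e3, e4⟩ := e
  have hres : resid (mle s 2) (mle s 3) s = upsilonHat s := by
    rw [e2, e3, hs.upsilonHat_eq]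
  have hge : upsilonHat s ≤ resid (θ 2) (θ 3) s := by
    rw [hs.resid_eq]
    linarith [quadratic_form_nonneg hA hdet (θ 2 - deltaHat s) (θ 3 - muHat s)]
  obtain ⟨n1, n2⟩ := normal_profile_le hθ.2.2 hs.upsilonHat_pos hge
  rw [hres, e4, e0, e1]
  by_cases hg : θ 0 = alphaHat s ∧ θ 1 = alphaHat s / meanFst s
  · rw [hg.1, hg.2]
    have : ¬ (θ 4 = upsilonHat s ∧ resid (θ 2) (θ 3) s = upsilonHat s) := by
      rintro ⟨h4, hr⟩
      have h23 : θ 2 = deltaHat s ∧ θ 3 = muHat s := by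
        by_contra hcon
        have hx : θ 2 - deltaHat s ≠ 0 ∨ θ 3 - muHat s ≠ 0 := by
          by_contra! h0
          exact hcon ⟨by linarith [h0.1], by linarith [h0.2]⟩
        have := quadratic_form_pos hA hdet hx
        rw [hs.resid_eq] at hr
        linarith
      refine hne ?_
      ext i
      fin_cases i
      exacts [hg.1, hg.2, h23.1, h23.2, h4]
    linarith [n2 this]
  · have := hs.gammaLogLik_lt hθ.1 hθ.2.1 hg
    linarith

theorem Generic.isMLE_iff {s : Fin n → ℝ × ℝ} (hs : Generic s)
    (θ : EuclideanSpace ℝ (Fin 5)) : IsMLE s θ ↔ θ = mle s := by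
  constructor
  · rintro ⟨hθ, hmax⟩
    by_contra hne
    exact absurd (hmax hs.mle_mem) (not_le.2 (hs.likelihood_lt hθ hne))
  · rintro rfl
    refine ⟨hs.mle_mem, fun θ' hθ' => ?_⟩
    by_cases h : θ' = mle s
    · rw [h]
      exact le_refl (likelihood s (mle s))
    · exact (hs.likelihood_lt hθ' h).le

end sample

/-! ### The linear expansion of the estimate -/

/-- An exact linearization, valid also at `x = a`; the slope tends to the derivative, so no
remainder term has to be controlled. -/
lemma sub_eq_dslope_mul (f : ℝ → ℝ) (a x : ℝ) : f x - f a = dslope f a x * (x - a) := by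
  have := sub_smul_dslope f a x
  rw [smul_eq_mul] at this
  rw [← this, mul_comm]

lemma measurable_dslope {f : ℝ → ℝ} (hf : Measurable f) (a : ℝ) : Measurable (dslope f a) := by
  have : dslope f a = fun x => if x = a then deriv f a else (f x - f a) / (x - a) := by
    ext x
    split_ifs with h
    · rw [h, dslope_same]
    · rw [dslope_of_ne f h, slope_def_field]
  rw [this]
  exact Measurable.ite (measurableSet_eq_fun measurable_id measurable_const) measurable_const
    (by fun_prop)

lemma tendsto_dslope {f : ℝ → ℝ} {f' a : ℝ} (hf : HasDerivAt f f' a) :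
    Tendsto (dslope f a) (𝓝 a) (𝓝 f') := by
  have h := (continuousAt_dslope_same.2 hf.differentiableAt).tendsto
  rwa [dslope_same, hf.deriv] at h

lemma measurable_logSubDigamma : Measurable logSubDigamma :=
  Real.measurable_log.sub (measurable_deriv _)

lemma tendsto_shapeOf {a : ℝ} (ha : 0 < a) :
    Tendsto shapeOf (𝓝 (logSubDigamma a)) (𝓝 a) := by
  rw [tendsto_order]
  constructor
  · intro c hc
    by_cases hc0 : 0 < c
    · have h := logSubDigamma_strictAntiOn hc0 ha hc
      filter_upwards [lt_mem_nhds (logSubDigamma_pos ha), gt_mem_nhds h] with s hs hs'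
      by_contra! hle
      rw [shapeOf_le_iff hs hc0] at hle
      linarith
    · exact Eventually.of_forall fun s => lt_of_le_of_lt (not_lt.1 hc0) (shapeOf_pos s)
  · intro c hc
    -- `shapeOf_le_iff` yields only a weak bound, so it is used at the midpoint to obtain a strict
    -- one at `c`.
    have hm : 0 < (a + c) / 2 := by linarith
    have h := logSubDigamma_strictAntiOn ha hm (show a < (a + c) / 2 by linarith)
    filter_upwards [lt_mem_nhds (logSubDigamma_pos ha), lt_mem_nhds h] with s hs hs'
    have := (shapeOf_le_iff hs hm).2 hs'.le
    linarith

/-- Injectivity of `log - ψ` off the base point and `ψ'(a) > 1 / a` at it; this makes the slope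
invertible for every sample, not only asymptotically. -/
lemma dslope_logSubDigamma_ne_zero {a x : ℝ} (ha : 0 < a) (hx : 0 < x) :
    dslope logSubDigamma a x ≠ 0 := by
  by_cases h : x = a
  · rw [h, dslope_same, (hasDerivAt_logSubDigamma ha).deriv]
    linarith [inv_lt_trigamma ha]
  · intro h0
    have := sub_eq_dslope_mul logSubDigamma a x
    rw [h0, zero_mul, sub_eq_zero] at this
    exact h (logSubDigamma_strictAntiOn.injOn hx ha this)

section expansion

variable {n : ℕ} (α β δ μ υ : ℝ)

/-- The empirical mean of the score. -/
noncomputable def meanScore (s : Fin n → ℝ × ℝ) (i : Fin 5) : ℝ :=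
  sampleMean (fun z => scoreFun α β δ μ υ z i) s

/-- The ratio between the errors of `α̂` and of the empirical log gap. -/
noncomputable def shapeSlope (s : Fin n → ℝ × ℝ) : ℝ :=
  (dslope logSubDigamma α (alphaHat s))⁻¹

/-- The ratio between the errors of the logarithm of the empirical mean of `x` and of this mean. -/
noncomputable def logSlope (s : Fin n → ℝ × ℝ) : ℝ := dslope Real.log (α / β) (meanFst s)

/-- The random matrix that maps the mean score to the estimation error. -/
noncomputable def expansion (s : Fin n → ℝ × ℝ) : Fin 5 → Fin 5 → ℝ :=
  ![![-shapeSlope α s, -(shapeSlope α s * logSlope α β s), 0, 0, 0],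
    ![-shapeSlope α s / meanFst s, (β - shapeSlope α s * logSlope α β s) / meanFst s, 0, 0, 0],
    ![0, 0, υ * meanFst s / (meanInv s * meanFst s - 1), -υ / (meanInv s * meanFst s - 1), 0],
    ![0, 0, -υ / (meanInv s * meanFst s - 1), υ * meanInv s / (meanInv s * meanFst s - 1), 0],
    ![0, 0, -(υ * (deltaHat s - δ)), -(υ * (muHat s - μ)), 2 * υ ^ 2]]

lemma measurable_expansion :
    Measurable (expansion α β δ μ υ : (Fin n → ℝ × ℝ) → Fin 5 → Fin 5 → ℝ) := by
  have h1 : Measurable (meanInv : (Fin n → ℝ × ℝ) → ℝ) := measurable_sampleMean (by fun_prop)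
  have h2 : Measurable (meanFst : (Fin n → ℝ × ℝ) → ℝ) := measurable_sampleMean (by fun_prop)
  have hmle : Measurable (mle : (Fin n → ℝ × ℝ) → EuclideanSpace ℝ (Fin 5)) := measurable_mle
  have ha : Measurable (alphaHat : (Fin n → ℝ × ℝ) → ℝ) :=
    (by fun_prop : Measurable fun v : EuclideanSpace ℝ (Fin 5) => v 0).comp hmle
  have hd : Measurable (deltaHat : (Fin n → ℝ × ℝ) → ℝ) :=
    (by fun_prop : Measurable fun v : EuclideanSpace ℝ (Fin 5) => v 2).comp hmle
  have hm : Measurable (muHat : (Fin n → ℝ × ℝ) → ℝ) :=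
    (by fun_prop : Measurable fun v : EuclideanSpace ℝ (Fin 5) => v 3).comp hmle
  have hs : Measurable (shapeSlope α : (Fin n → ℝ × ℝ) → ℝ) :=
    ((measurable_dslope measurable_logSubDigamma α).comp ha).inv
  have hl : Measurable (logSlope α β : (Fin n → ℝ × ℝ) → ℝ) :=
    (measurable_dslope Real.measurable_log (α / β)).comp h2
  refine measurable_pi_lambda _ fun i => measurable_pi_lambda _ fun j => ?_
  fin_cases i <;> fin_cases j <;> simp [expansion] <;> fun_prop

variable {α β δ μ υ}

/-! ### The mean score in terms of empirical means. -/

lemma sampleMean_const (c : ℝ) {s : Fin n → ℝ × ℝ} (hn : 0 < (n : ℝ)) :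
    sampleMean (fun _ => c) s = c := by
  simp only [sampleMean, Finset.sum_const, Finset.card_univ, Fintype.card_fin, nsmul_eq_mul]
  field_simp

lemma sampleMean_congr {f g : ℝ × ℝ → ℝ} {s : Fin n → ℝ × ℝ} (h : ∀ i, f (s i) = g (s i)) :
    sampleMean f s = sampleMean g s := by
  simp only [sampleMean, h]

lemma sampleMean_add (f g : ℝ × ℝ → ℝ) (s : Fin n → ℝ × ℝ) :
    sampleMean (fun z => f z + g z) s = sampleMean f s + sampleMean g s := by
  simp only [sampleMean, Finset.sum_add_distrib, add_div]

lemma sampleMean_const_mul (c : ℝ) (f : ℝ × ℝ → ℝ) (s : Fin n → ℝ × ℝ) :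
    sampleMean (fun z => c * f z) s = c * sampleMean f s := by
  simp only [sampleMean, ← Finset.mul_sum, mul_div_assoc]

lemma Generic.meanScore_zero {s : Fin n → ℝ × ℝ} (hs : Generic s) :
    meanScore α β δ μ υ s 0 = Real.log β - digamma α + meanLog s := by
  rw [meanScore, meanLog, ← sampleMean_const (Real.log β - digamma α) (s := s) hs.n_pos,
    ← sampleMean_add]
  rfl

lemma Generic.meanScore_one {s : Fin n → ℝ × ℝ} (hs : Generic s) :
    meanScore α β δ μ υ s 1 = α / β - meanFst s := by
  rw [meanScore, meanFst, ← sampleMean_const (α / β) (s := s) hs.n_pos, sub_eq_add_neg,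
    neg_eq_neg_one_mul, ← sampleMean_const_mul, ← sampleMean_add]
  refine sampleMean_congr fun i => ?_
  simp [scoreFun]
  ring

lemma Generic.meanScore_two {s : Fin n → ℝ × ℝ} (hs : Generic s) (hυ : 0 < υ) :
    υ * meanScore α β δ μ υ s 2 =
      sampleMean (fun z => z.2 / z.1) s - δ * meanInv s - μ := by
  have h : υ * meanScore α β δ μ υ s 2 =
      sampleMean (fun z => z.2 / z.1) s + (-δ) * meanInv s + -μ := by
    rw [meanScore, meanInv, ← sampleMean_const (-μ) (s := s) hs.n_pos, ← sampleMean_const_mul,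
      ← sampleMean_const_mul, ← sampleMean_add, ← sampleMean_add]
    refine sampleMean_congr fun i => ?_
    have := (hs.pos i).ne'
    simp [scoreFun]
    field_simp
    ring
  rw [h]
  ring

lemma Generic.meanScore_three {s : Fin n → ℝ × ℝ} (hs : Generic s) (hυ : 0 < υ) :
    υ * meanScore α β δ μ υ s 3 = sampleMean (fun z => z.2) s - δ - μ * meanFst s := by
  have h : υ * meanScore α β δ μ υ s 3 =
      sampleMean (fun z => z.2) s + (-μ) * meanFst s + -δ := by
    rw [meanScore, meanFst, ← sampleMean_const (-δ) (s := s) hs.n_pos, ← sampleMean_const_mul,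
      ← sampleMean_const_mul, ← sampleMean_add, ← sampleMean_add]
    refine sampleMean_congr fun i => ?_
    simp [scoreFun]
    field_simp
    ring
  rw [h]
  ring

lemma Generic.meanScore_four {s : Fin n → ℝ × ℝ} (hs : Generic s) (hυ : 0 < υ) :
    2 * υ ^ 2 * meanScore α β δ μ υ s 4 = resid δ μ s - υ := by
  have h : 2 * υ ^ 2 * meanScore α β δ μ υ s 4 = resid δ μ s + -υ := by
    rw [meanScore, resid, ← sampleMean_const (-υ) (s := s) hs.n_pos, ← sampleMean_const_mul,
      ← sampleMean_add]
    refine sampleMean_congr fun i => ?_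
    have := (hs.pos i).ne'
    simp [scoreFun]
    field_simp
    ring
  rw [h]
  ring

/-! ### Exact errors of the five estimates. -/

lemma Generic.deltaHat_sub {s : Fin n → ℝ × ℝ} (hs : Generic s) (hυ : 0 < υ) :
    deltaHat s - δ = υ * meanFst s / (meanInv s * meanFst s - 1) * meanScore α β δ μ υ s 2 +
      -υ / (meanInv s * meanFst s - 1) * meanScore α β δ μ υ s 3 := by
  have hD := hs.det_pos.ne'
  have h2 := hs.meanScore_two (α := α) (β := β) (δ := δ) (μ := μ) hυ
  have h3 := hs.meanScore_three (α := α) (β := β) (δ := δ) (μ := μ) hυ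
  have e : υ * meanFst s / (meanInv s * meanFst s - 1) * meanScore α β δ μ υ s 2 +
      -υ / (meanInv s * meanFst s - 1) * meanScore α β δ μ υ s 3 =
      (meanFst s * (υ * meanScore α β δ μ υ s 2) - υ * meanScore α β δ μ υ s 3) /
        (meanInv s * meanFst s - 1) := by
    ring
  rw [e, h2, h3, deltaHat, eq_div_iff hD, sub_mul, div_mul_cancel₀ _ hD]
  ring

lemma Generic.muHat_sub {s : Fin n → ℝ × ℝ} (hs : Generic s) (hυ : 0 < υ) :
    muHat s - μ = -υ / (meanInv s * meanFst s - 1) * meanScore α β δ μ υ s 2 +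
      υ * meanInv s / (meanInv s * meanFst s - 1) * meanScore α β δ μ υ s 3 := by
  have hD := hs.det_pos.ne'
  have h2 := hs.meanScore_two (α := α) (β := β) (δ := δ) (μ := μ) hυ
  have h3 := hs.meanScore_three (α := α) (β := β) (δ := δ) (μ := μ) hυ
  have e : -υ / (meanInv s * meanFst s - 1) * meanScore α β δ μ υ s 2 +
      υ * meanInv s / (meanInv s * meanFst s - 1) * meanScore α β δ μ υ s 3 =
      (meanInv s * (υ * meanScore α β δ μ υ s 3) - υ * meanScore α β δ μ υ s 2) /
        (meanInv s * meanFst s - 1) := by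
    ring
  rw [e, h2, h3, muHat, eq_div_iff hD, sub_mul, div_mul_cancel₀ _ hD]
  ring

/-- The estimate is the residual mean square at the true line minus a quadratic form in the errors
of `δ` and `μ`. By the normal equations one factor of that form is a mean score, so the coefficients
left are themselves errors and vanish in the limit. -/
lemma Generic.upsilonHat_sub {s : Fin n → ℝ × ℝ} (hs : Generic s) (hυ : 0 < υ) :
    upsilonHat s - υ = -(υ * (deltaHat s - δ)) * meanScore α β δ μ υ s 2 +
      -(υ * (muHat s - μ)) * meanScore α β δ μ υ s 3 +
      2 * υ ^ 2 * meanScore α β δ μ υ s 4 := by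
  obtain ⟨n1, n2⟩ := normal_equations hs.det_pos.ne'
  have e : -(υ * (deltaHat s - δ)) * meanScore α β δ μ υ s 2 +
      -(υ * (muHat s - μ)) * meanScore α β δ μ υ s 3 =
      -(deltaHat s - δ) * (υ * meanScore α β δ μ υ s 2) -
      (muHat s - μ) * (υ * meanScore α β δ μ υ s 3) := by ring
  rw [e, hs.meanScore_two hυ, hs.meanScore_three hυ, hs.meanScore_four hυ, hs.resid_eq, ← n1, ← n2]
  ring

/-- Two exact linearizations: `log - ψ` turns the shape error into the error of the log gap, and
`log` turns the error of `log (mean x)` into that of the mean. What remains are the first two mean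
scores. -/
lemma Generic.alphaHat_sub {s : Fin n → ℝ × ℝ} (hs : Generic s) (hα : 0 < α) (hβ : 0 < β) :
    alphaHat s - α = -shapeSlope α s * meanScore α β δ μ υ s 0 +
      -(shapeSlope α s * logSlope α β s) * meanScore α β δ μ υ s 1 := by
  have h1 := sub_eq_dslope_mul logSubDigamma α (alphaHat s)
  have h2 := sub_eq_dslope_mul Real.log (α / β) (meanFst s)
  have h3 : logSubDigamma (alphaHat s) = Real.log (meanFst s) - meanLog s :=
    logSubDigamma_shapeOf hs.log_gap_pos
  have hne : dslope logSubDigamma α (alphaHat s) ≠ 0 :=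
    dslope_logSubDigamma_ne_zero hα (shapeOf_pos _)
  have h4 : alphaHat s - α = shapeSlope α s * (logSubDigamma (alphaHat s) - logSubDigamma α) := by
    rw [h1, shapeSlope, inv_mul_cancel_left₀ hne]
  have h5 : -(shapeSlope α s * logSlope α β s) * (α / β - meanFst s) =
      shapeSlope α s * (logSlope α β s * (meanFst s - α / β)) := by ring
  rw [hs.meanScore_zero, hs.meanScore_one, h4, h3, h5, logSlope, ← h2,
    Real.log_div hα.ne' hβ.ne', logSubDigamma]
  ring

lemma Generic.betaHat_sub {s : Fin n → ℝ × ℝ} (hs : Generic s) (hα : 0 < α) (hβ : 0 < β) :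
    alphaHat s / meanFst s - β = -shapeSlope α s / meanFst s * meanScore α β δ μ υ s 0 +
      (β - shapeSlope α s * logSlope α β s) / meanFst s * meanScore α β δ μ υ s 1 := by
  have hB := hs.meanFst_pos.ne'
  have h := hs.alphaHat_sub (δ := δ) (μ := μ) (υ := υ) hα hβ
  have e : alphaHat s / meanFst s - β =
      ((alphaHat s - α) + β * meanScore α β δ μ υ s 1) / meanFst s := by
    rw [hs.meanScore_one]
    field_simp
    ring
  rw [e, h]
  ring

theorem Generic.mle_sub {s : Fin n → ℝ × ℝ} (hs : Generic s) (hα : 0 < α) (hβ : 0 < β)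
    (hυ : 0 < υ) (i : Fin 5) :
    mle s i - !₂[α, β, δ, μ, υ] i =
      ∑ j, expansion α β δ μ υ s i j * meanScore α β δ μ υ s j := by
  have h0 := hs.alphaHat_sub (δ := δ) (μ := μ) (υ := υ) hα hβ
  have h1 := hs.betaHat_sub (δ := δ) (μ := μ) (υ := υ) hα hβ
  have h2 := hs.deltaHat_sub (α := α) (β := β) (δ := δ) (μ := μ) hυ
  have h3 := hs.muHat_sub (α := α) (β := β) (δ := δ) (μ := μ) hυ
  have h4 := hs.upsilonHat_sub (α := α) (β := β) (δ := δ) (μ := μ) hυ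
  fin_cases i <;> simp [mle, expansion, Fin.sum_univ_five]
  · linarith
  · linarith
  · linarith
  · linarith
  · linarith

end expansion

/-! ### Almost sure properties of the sample -/

/-- The first `n` observations. -/
def sample {Ω : Type*} (Z : ℕ → Ω → ℝ × ℝ) (n : ℕ) (ω : Ω) : Fin n → ℝ × ℝ := fun i => Z i ω

lemma sampleMean_sample {Ω : Type*} {Z : ℕ → Ω → ℝ × ℝ} (f : ℝ × ℝ → ℝ) (n : ℕ) (ω : Ω) :
    sampleMean f (sample Z n ω) = (∑ k ∈ Finset.range n, f (Z k ω)) / n := by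
  rw [Finset.sum_range]
  rfl

section sample_path

variable {α β δ μ σ : ℝ}

/-! ### Laws of large numbers and almost sure general position. -/

lemma map_fst_law (hα : 0 < α) (hβ : 0 < β) :
    (law α β δ μ σ).map Prod.fst = gammaMeasure α β := by
  have := isProbabilityMeasure_gammaMeasure hα hβ
  rw [law_eq_map, Measure.map_map measurable_fst (measurable_lawMap δ μ σ)]
  exact measurePreserving_fst.map_eq

lemma integral_fst_law (hα : 0 < α) (hβ : 0 < β) {f : ℝ → ℝ} (hf : Measurable f) :
    ∫ z, f z.1 ∂law α β δ μ σ = ∫ x, f x ∂gammaMeasure α β := by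
  rw [← map_fst_law (δ := δ) (μ := μ) (σ := σ) hα hβ,
    integral_map measurable_fst.aemeasurable hf.aestronglyMeasurable]

lemma integrable_fst_law (hα : 0 < α) (hβ : 0 < β) {f : ℝ → ℝ} (hf : Measurable f)
    (h : Integrable f (gammaMeasure α β)) : Integrable (fun z => f z.1) (law α β δ μ σ) := by
  rw [← map_fst_law (δ := δ) (μ := μ) (σ := σ) hα hβ,
    integrable_map_measure hf.aestronglyMeasurable measurable_fst.aemeasurable] at h
  exact h

variable {Ω : Type*} [MeasurableSpace Ω] {P : Measure Ω} {Z : ℕ → Ω → ℝ × ℝ}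

lemma tendsto_sampleMean (hlaw : ∀ i, HasLaw (Z i) (law α β δ μ σ) P) (hindep : iIndepFun Z P)
    {f : ℝ × ℝ → ℝ} (hf : Measurable f) (hint : Integrable f (law α β δ μ σ)) :
    ∀ᵐ ω ∂P, Tendsto (fun n => sampleMean f (sample Z n ω)) atTop
      (𝓝 (∫ z, f z ∂law α β δ μ σ)) := by
  have h := strong_law_ae_real (μ := P) (fun k ω => f (Z k ω)) ?_ ?_ ?_
  · rw [(hlaw 0).integral_comp (f := f) hf.aestronglyMeasurable |>.symm]
    filter_upwards [h] with ω hω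
    simpa only [sampleMean_sample, Function.comp_apply] using hω
  · have := (hlaw 0).map_eq ▸ hint
    exact (integrable_map_measure hf.aestronglyMeasurable (hlaw 0).aemeasurable).1 this
  · exact fun i j hij => (hindep.indepFun hij).comp hf hf
  · exact fun i => ((hlaw i).identDistrib (hlaw 0)).comp hf

lemma tendsto_meanScore (hα : 1 < α) (hβ : 0 < β) (hσ : 0 < σ)
    (hlaw : ∀ i, HasLaw (Z i) (law α β δ μ σ) P) (hindep : iIndepFun Z P) (i : Fin 5) :
    ∀ᵐ ω ∂P, Tendsto (fun n => meanScore α β δ μ (σ ^ 2) (sample Z n ω) i) atTop (𝓝 0) := by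
  have := isProbabilityMeasure_law (show 0 < α by linarith) hβ δ μ σ
  have hm := measurable_scoreFun α β δ μ (σ ^ 2)
  rw [← integral_scoreFun_eq_zero (δ := δ) (μ := μ) hα hβ hσ i]
  exact tendsto_sampleMean hlaw hindep (f := fun z => scoreFun α β δ μ (σ ^ 2) z i) (by fun_prop)
    ((memLp_scoreFun hα hβ hσ i).integrable (by norm_num))

variable [IsProbabilityMeasure P]

/-- Only the first three observations matter. The first two have distinct abscissae, and the third,
independent of them, misses the line through them because lines are null sets of the law. -/
lemma generic_ae (hα : 0 < α) (hβ : 0 < β) (hσ : 0 < σ)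
    (hlaw : ∀ i, HasLaw (Z i) (law α β δ μ σ) P) (hindep : iIndepFun Z P) {n : ℕ} (hn : 3 ≤ n) :
    ∀ᵐ ω ∂P, Generic (sample Z n ω) := by
  have hP := isProbabilityMeasure_law hα hβ δ μ σ
  have hm i : AEMeasurable (Z i) P := (hlaw i).aemeasurable
  have hpos : ∀ᵐ ω ∂P, ∀ i, 0 < (Z i ω).1 := by
    refine ae_all_iff.2 fun i => ae_of_ae_map (p := fun z : ℝ × ℝ => 0 < z.1) (hm i) ?_
    rw [(hlaw i).map_eq]
    exact law_ae_pos hα hβ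
  have hpair : P.map (fun ω => (Z 0 ω, Z 1 ω)) = (law α β δ μ σ).prod (law α β δ μ σ) := by
    have := (indepFun_iff_map_prod_eq_prod_map_map (hm 0) (hm 1)).1
      (hindep.indepFun (show 0 ≠ 1 by decide))
    rw [this, (hlaw 0).map_eq, (hlaw 1).map_eq]
  have htriple : P.map (fun ω => ((Z 0 ω, Z 1 ω), Z 2 ω)) =
      ((law α β δ μ σ).prod (law α β δ μ σ)).prod (law α β δ μ σ) := by
    have := (indepFun_iff_map_prod_eq_prod_map_map ((hm 0).prodMk (hm 1)) (hm 2)).1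
      (hindep.indepFun_prodMk₀ hm 0 1 2 (by decide) (by decide))
    rw [this, (hlaw 2).map_eq, hpair]
  have hne : ∀ᵐ ω ∂P, (Z 1 ω).1 ≠ (Z 0 ω).1 := by
    refine ae_of_ae_map (p := fun z : (ℝ × ℝ) × (ℝ × ℝ) => z.2.1 ≠ z.1.1)
      ((hm 0).prodMk (hm 1)) ?_
    rw [hpair]
    refine (Measure.ae_prod_iff_ae_ae (p := fun z : (ℝ × ℝ) × (ℝ × ℝ) => z.2.1 ≠ z.1.1)
      (measurableSet_eq_fun (by fun_prop) (by fun_prop)).compl).2 ?_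
    exact ae_of_all _ fun z => law_ae_fst_ne hα hβ z.1
  -- Noncollinearity is written without division, so that the event is measurable by comparison of
  -- polynomials.
  have hline : ∀ᵐ ω ∂P, (Z 1 ω).1 ≠ (Z 0 ω).1 →
      ((Z 2 ω).2 - (Z 0 ω).2) * ((Z 1 ω).1 - (Z 0 ω).1) ≠
        ((Z 1 ω).2 - (Z 0 ω).2) * ((Z 2 ω).1 - (Z 0 ω).1) := by
    let p : ((ℝ × ℝ) × (ℝ × ℝ)) × (ℝ × ℝ) → Prop := fun z => z.1.2.1 ≠ z.1.1.1 →
      (z.2.2 - z.1.1.2) * (z.1.2.1 - z.1.1.1) ≠ (z.1.2.2 - z.1.1.2) * (z.2.1 - z.1.1.1)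
    refine ae_of_ae_map (p := p) (((hm 0).prodMk (hm 1)).prodMk (hm 2)) ?_
    rw [htriple]
    have hpm : MeasurableSet {z | p z} := by
      have h1 : MeasurableSet {z : ((ℝ × ℝ) × (ℝ × ℝ)) × (ℝ × ℝ) | z.1.2.1 = z.1.1.1} :=
        measurableSet_eq_fun (by fun_prop) (by fun_prop)
      have h2 : MeasurableSet {z : ((ℝ × ℝ) × (ℝ × ℝ)) × (ℝ × ℝ) |
          (z.2.2 - z.1.1.2) * (z.1.2.1 - z.1.1.1) = (z.1.2.2 - z.1.1.2) * (z.2.1 - z.1.1.1)} :=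
        measurableSet_eq_fun (by fun_prop) (by fun_prop)
      convert! h1.union h2.compl using 1
      ext z
      simp only [p, Set.mem_ofPred_eq, Set.mem_union, Set.mem_compl_iff]
      tauto
    refine (Measure.ae_prod_iff_ae_ae (p := p) hpm).2 (ae_of_all _ fun w => ?_)
    by_cases hw : w.2.1 = w.1.1
    · exact ae_of_all _ fun z h => absurd hw h
    have hw' : w.2.1 - w.1.1 ≠ 0 := sub_ne_zero.2 hw
    have := law_ae_ne_line (δ := δ) (μ := μ) hα hβ hσ
      (w.1.2 - (w.2.2 - w.1.2) / (w.2.1 - w.1.1) * w.1.1)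
      ((w.2.2 - w.1.2) / (w.2.1 - w.1.1))
    filter_upwards [this] with z hz _ h
    refine hz ?_
    field_simp
    simp only at h
    linarith
  filter_upwards [hpos, hne, hline] with ω h1 h2 h3
  have h3' := h3 h2
  refine ⟨fun i => h1 i, fun a => ?_, fun d m => ?_⟩
  · by_contra! h
    have e0 := h ⟨0, by omega⟩
    have e1 := h ⟨1, by omega⟩
    simp only [sample] at e0 e1
    exact h2 (e1.trans e0.symm)
  · by_contra! h
    have e0 := h ⟨0, by omega⟩
    have e1 := h ⟨1, by omega⟩
    have e2 := h ⟨2, by omega⟩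
    simp only [sample] at e0 e1 e2
    refine h3' ?_
    rw [e0, e1, e2]
    ring

theorem tendsto_expansion (hα : 1 < α) (hβ : 0 < β) (hσ : 0 < σ)
    (hlaw : ∀ i, HasLaw (Z i) (law α β δ μ σ) P) (hindep : iIndepFun Z P) :
    ∀ᵐ ω ∂P, Tendsto (fun n => expansion α β δ μ (σ ^ 2) (sample Z n ω)) atTop
      (𝓝 (asymptoticCov α β σ)) := by
  have hα' : 0 < α := by linarith
  have hα1 : 0 < α - 1 := by linarith
  have hυ : 0 < σ ^ 2 := by positivity
  have hD := mul_trigamma_sub_one_pos hα'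
  have := isProbabilityMeasure_gammaMeasure hα' hβ
  have hA := tendsto_sampleMean hlaw hindep (f := fun z => z.1⁻¹) (by fun_prop)
    (integrable_fst_law hα' hβ (f := fun x => x⁻¹) (by fun_prop)
      (integrable_inv_gammaMeasure hα hβ))
  have hB := tendsto_sampleMean hlaw hindep (f := fun z => z.1) (by fun_prop)
    (integrable_fst_law hα' hβ (f := fun x => x) (by fun_prop)
      ((memLp_id_gammaMeasure hα' hβ).integrable (by norm_num)))
  have hL := tendsto_sampleMean hlaw hindep (f := fun z => Real.log z.1) (by fun_prop)
    (integrable_fst_law hα' hβ (f := Real.log) (by fun_prop)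
      ((memLp_log_gammaMeasure hα' hβ).integrable (by norm_num)))
  rw [integral_fst_law hα' hβ (f := fun x => x⁻¹) (by fun_prop),
    integral_inv_gammaMeasure hα hβ] at hA
  rw [integral_fst_law hα' hβ (f := fun x => x) (by fun_prop),
    integral_id_gammaMeasure hα' hβ] at hB
  rw [integral_fst_law hα' hβ (f := Real.log) (by fun_prop),
    integral_log_gammaMeasure hα' hβ] at hL
  -- One null set serves all `n`, so the exact error formulas hold along the whole sample path.
  have hgen : ∀ᵐ ω ∂P, ∀ n, 3 ≤ n → Generic (sample Z n ω) :=
    ae_all_iff.2 fun n => by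
      by_cases hn : 3 ≤ n
      · filter_upwards [generic_ae hα' hβ hσ hlaw hindep hn] with ω h _ using h
      · exact ae_of_all _ fun ω h => absurd h hn
  filter_upwards [hA, hB, hL, hgen, tendsto_meanScore hα hβ hσ hlaw hindep 2,
    tendsto_meanScore hα hβ hσ hlaw hindep 3] with ω hA hB hL hgen hS2 hS3
  replace hA : Tendsto (fun n => meanInv (sample Z n ω)) atTop (𝓝 (β / (α - 1))) := hA
  replace hB : Tendsto (fun n => meanFst (sample Z n ω)) atTop (𝓝 (α / β)) := hB
  replace hL : Tendsto (fun n => meanLog (sample Z n ω)) atTop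
    (𝓝 (digamma α - Real.log β)) := hL
  have hαβ : 0 < α / β := by positivity
  have hgap : Tendsto (fun n => Real.log (meanFst (sample Z n ω)) - meanLog (sample Z n ω)) atTop
      (𝓝 (logSubDigamma α)) := by
    have := (((Real.continuousAt_log hαβ.ne').tendsto.comp hB).sub hL)
    rw [Real.log_div hα'.ne' hβ.ne'] at this
    convert! this using 2
    rw [logSubDigamma]
    ring
  have hα_tend : Tendsto (fun n => alphaHat (sample Z n ω)) atTop (𝓝 α) :=
    (tendsto_shapeOf hα').comp hgap
  have hder : 1 / α - trigamma α ≠ 0 := by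
    linarith [inv_lt_trigamma hα']
  have hshape : Tendsto (fun n => shapeSlope α (sample Z n ω)) atTop
      (𝓝 (1 / α - trigamma α)⁻¹) :=
    ((tendsto_dslope (hasDerivAt_logSubDigamma hα')).comp hα_tend).inv₀ hder
  have hlog : Tendsto (fun n => logSlope α β (sample Z n ω)) atTop (𝓝 (α / β)⁻¹) :=
    (tendsto_dslope (Real.hasDerivAt_log hαβ.ne')).comp hB
  have hdet : Tendsto (fun n => meanInv (sample Z n ω) * meanFst (sample Z n ω) - 1) atTop
      (𝓝 (1 / (α - 1))) := by
    convert! (hA.mul hB).sub_const 1 using 2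
    field_simp
    ring
  have hdet0 : 1 / (α - 1) ≠ 0 := by positivity
  have t22 := ((hB.const_mul (σ ^ 2)).div hdet hdet0)
  have t23 := ((tendsto_const_nhds (x := -σ ^ 2)).div hdet hdet0)
  have t33 := ((hA.const_mul (σ ^ 2)).div hdet hdet0)
  -- Consistency comes from the error formula itself: convergent coefficients times mean scores that
  -- tend to zero. It is needed for the last row of the matrix, whose entries contain these errors.
  have hd : Tendsto (fun n => deltaHat (sample Z n ω) - δ) atTop (𝓝 0) := by
    have h := (t22.mul hS2).add (t23.mul hS3)
    rw [mul_zero, mul_zero, add_zero] at h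
    refine h.congr' ?_
    filter_upwards [eventually_ge_atTop 3] with n hn
    exact ((hgen n hn).deltaHat_sub hυ).symm
  have hm : Tendsto (fun n => muHat (sample Z n ω) - μ) atTop (𝓝 0) := by
    have h := (t23.mul hS2).add (t33.mul hS3)
    rw [mul_zero, mul_zero, add_zero] at h
    refine h.congr' ?_
    filter_upwards [eventually_ge_atTop 3] with n hn
    exact ((hgen n hn).muHat_sub hυ).symm
  have hderiv : (1 / α - trigamma α)⁻¹ = -(α / (α * trigamma α - 1)) := by
    have : 1 / α - trigamma α = -((α * trigamma α - 1) / α) := by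
      field_simp
      ring
    rw [this, inv_neg, inv_div]
  rw [hderiv] at hshape
  refine tendsto_pi_nhds.2 fun i => tendsto_pi_nhds.2 fun j => ?_
  fin_cases i <;> fin_cases j <;>
    simp only [expansion, asymptoticCov, Fin.zero_eta, Fin.mk_one, Fin.reduceFinMk,
      Matrix.cons_val, Matrix.of_apply, Matrix.cons_val_zero, Matrix.cons_val_one] <;>
    try exact tendsto_const_nhds
  · convert! hshape.neg using 2
    simp [covAlphaBeta]
    field_simp
  · convert! (hshape.mul hlog).neg using 2
    simp [covAlphaBeta]
    field_simp
  · convert! hshape.neg.div hB hαβ.ne' using 2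
    simp [covAlphaBeta]
    field_simp
  · convert! ((hshape.mul hlog).const_sub β).div hB hαβ.ne' using 2
    simp [covAlphaBeta]
    field_simp
    ring
  · convert! t22 using 2
    simp [covDeltaMu]
    field_simp
  · convert! t23 using 2
    simp [covDeltaMu]
    field_simp
  · convert! t23 using 2
    simp [covDeltaMu]
    field_simp
  · convert! t33 using 2
    simp [covDeltaMu]
    field_simp
  · convert! (hd.const_mul (σ ^ 2)).neg using 2
    simp
  · convert! (hm.const_mul (σ ^ 2)).neg using 2
    simp
  · convert! tendsto_const_nhds using 2
    ring

end sample_path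

/-! ### Convergence in distribution -/

section convergence

variable {Ω : Type*} [MeasurableSpace Ω] {P : Measure Ω} [IsProbabilityMeasure P]

lemma tendstoInDistribution_of_eventually_ae_eq {Ω' E : Type*} [MeasurableSpace Ω']
    {μ' : Measure Ω'} [IsProbabilityMeasure μ'] [TopologicalSpace E] [MeasurableSpace E]
    [OpensMeasurableSpace E] {U V : ℕ → Ω → E} {W : Ω' → E}
    (h : TendstoInDistribution U atTop W (fun _ => P) μ') (hV : ∀ n, AEMeasurable (V n) P)
    (hUV : ∀ᶠ n in atTop, U n =ᵐ[P] V n) :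
    TendstoInDistribution V atTop W (fun _ => P) μ' := by
  refine ⟨hV, h.aemeasurable_limit, h.tendsto.congr' ?_⟩
  filter_upwards [hUV] with n hn
  exact Subtype.ext (Measure.map_congr hn)

lemma TendstoInDistribution.of_map_eq {Ω' E : Type*} [MeasurableSpace Ω']
    {μ' : Measure Ω'} [IsProbabilityMeasure μ'] [TopologicalSpace E] [MeasurableSpace E]
    [OpensMeasurableSpace E] {U : ℕ → Ω → E} {W : Ω' → E} {ν : Measure E} [IsProbabilityMeasure ν]
    (h : TendstoInDistribution U atTop W (fun _ => P) μ') (hν : μ'.map W = ν) :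
    TendstoInDistribution U atTop id (fun _ => P) ν := by
  refine ⟨h.forall_aemeasurable, aemeasurable_id, ?_⟩
  convert! h.tendsto using 2
  exact congrArg 𝓝 (Subtype.ext (Measure.map_id.trans hν.symm))

/-- Compare characteristic functions, moving `M` to the argument `t` as its transpose. -/
lemma map_mulVec_multivariateGaussian {ι : Type*} [Fintype ι] [DecidableEq ι]
    {S : Matrix ι ι ℝ} (hS : S.PosSemidef) (M : Matrix ι ι ℝ) :
    (multivariateGaussian 0 S).map (fun v => WithLp.toLp 2 (M.mulVec v.ofLp)) =
      multivariateGaussian 0 (M * S * M.transpose) := by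
  have hc : Continuous fun v : EuclideanSpace ℝ ι =>
      (WithLp.toLp 2 (M.mulVec v.ofLp) : EuclideanSpace ℝ ι) := by
    fun_prop
  have := Measure.isProbabilityMeasure_map (μ := multivariateGaussian 0 S) hc.aemeasurable
  have hMS : (M * S * M.transpose).PosSemidef := by
    have := hS.mul_mul_conjTranspose_same M
    rwa [Matrix.conjTranspose_eq_transpose_of_trivial] at this
  refine Measure.ext_of_charFun (funext fun t => ?_)
  have e : charFun ((multivariateGaussian 0 S).map
      (fun v => WithLp.toLp 2 (M.mulVec v.ofLp))) t =
      charFun (multivariateGaussian 0 S) (WithLp.toLp 2 (M.transpose.mulVec t.ofLp)) := by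
    rw [charFun_apply, charFun_apply, integral_map hc.aemeasurable (by fun_prop)]
    congr with v
    congr 3
    rw [EuclideanSpace.inner_eq_star_dotProduct, EuclideanSpace.inner_eq_star_dotProduct]
    simp [Matrix.dotProduct_mulVec, Matrix.mulVec_transpose]
  rw [e, charFun_multivariateGaussian hS, charFun_multivariateGaussian hMS, inner_zero_right,
    inner_zero_right]
  congr 4
  simp only [Matrix.dotProduct_mulVec, Matrix.mulVec_transpose, ← Matrix.vecMul_vecMul]
  rw [Matrix.vecMul_transpose, dotProduct_comm (M.mulVec _), Matrix.dotProduct_mulVec,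
    dotProduct_comm]

variable {α β δ μ σ : ℝ} {Z : ℕ → Ω → ℝ × ℝ}

lemma tendstoInDistribution_meanScore (hα : 1 < α) (hβ : 0 < β) (hσ : 0 < σ)
    (hlaw : ∀ i, HasLaw (Z i) (law α β δ μ σ) P) (hindep : iIndepFun Z P) :
    TendstoInDistribution (fun (n : ℕ) ω =>
      (√(n : ℝ))⁻¹ • ∑ k ∈ Finset.range n, scoreFun α β δ μ (σ ^ 2) (Z k ω)) atTop id (fun _ => P)
      (multivariateGaussian 0 (fisherMatrix α β σ)) := by
  have hm := measurable_scoreFun α β δ μ (σ ^ 2)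
  have hi (i : Fin 5) : Measurable fun z => scoreFun α β δ μ (σ ^ 2) z i := by fun_prop
  refine multivariate_central_limit (W := fun k ω => scoreFun α β δ μ (σ ^ 2) (Z k ω))
    (hindep.comp (fun _ => scoreFun α β δ μ (σ ^ 2)) fun _ => hm)
    (fun k => ((hlaw k).identDistrib (hlaw 0)).comp hm) (fun i => ?_) (fun i => ?_)
    (posDef_fisherMatrix hα hβ hσ).posSemidef (fun i j => ?_)
  · have h := memLp_scoreFun (δ := δ) (μ := μ) hα hβ hσ i
    rw [← (hlaw 0).map_eq, memLp_map_measure_iff (hi i).aestronglyMeasurable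
      (hlaw 0).aemeasurable] at h
    exact h
  · rw [← integral_scoreFun_eq_zero (δ := δ) (μ := μ) hα hβ hσ i]
    exact (hlaw 0).integral_comp (hi i).aestronglyMeasurable
  · rw [← integral_scoreFun_mul_eq (δ := δ) (μ := μ) hα hβ hσ i j]
    exact (hlaw 0).integral_comp ((hi i).mul (hi j)).aestronglyMeasurable

theorem tendstoInDistribution_mle (hα : 1 < α) (hβ : 0 < β) (hσ : 0 < σ)
    (hlaw : ∀ i, HasLaw (Z i) (law α β δ μ σ) P) (hindep : iIndepFun Z P)
    {θhat : ℕ → Ω → EuclideanSpace ℝ (Fin 5)} (hmeas : ∀ n, AEMeasurable (θhat n) P)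
    (hmle : ∀ n, 3 ≤ n → ∀ᵐ ω ∂P, IsMLE (sample Z n ω) (θhat n ω)) :
    TendstoInDistribution (fun (n : ℕ) ω => √(n : ℝ) • (θhat n ω - !₂[α, β, δ, μ, σ ^ 2])) atTop
      id (fun _ => P) (multivariateGaussian 0 (asymptoticCov α β σ)) := by
  have hα' : 0 < α := by linarith
  have hsample (n : ℕ) : AEMeasurable (sample Z n) P :=
    aemeasurable_pi_lambda _ fun i => (hlaw i).aemeasurable
  have hR (n : ℕ) : AEMeasurable (fun ω => expansion α β δ μ (σ ^ 2) (sample Z n ω)) P :=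
    (measurable_expansion α β δ μ (σ ^ 2)).comp_aemeasurable (hsample n)
  -- Slutsky's theorem needs the random matrix to converge in probability to a constant.
  have hprob := tendstoInMeasure_of_tendsto_ae (fun n => (hR n).aestronglyMeasurable)
    (tendsto_expansion hα hβ hσ hlaw hindep)
  let g : EuclideanSpace ℝ (Fin 5) × (Fin 5 → Fin 5 → ℝ) → EuclideanSpace ℝ (Fin 5) :=
    fun p => WithLp.toLp 2 fun i => ∑ j, p.2 i j * p.1 j
  have hg : Continuous g := by
    refine (PiLp.continuous_toLp 2 _).comp (continuous_pi fun i => ?_)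
    fun_prop
  have h1 := (tendstoInDistribution_meanScore hα hβ hσ hlaw
    hindep).continuous_comp_prodMk_of_tendstoInMeasure_const hg hprob hR
  refine TendstoInDistribution.of_map_eq (tendstoInDistribution_of_eventually_ae_eq h1
    (fun n => ((hmeas n).sub_const _).const_smul (√(n : ℝ))) ?_) ?_
  · filter_upwards [eventually_ge_atTop 3] with n hn
    filter_upwards [generic_ae hα' hβ hσ hlaw hindep hn, hmle n hn] with ω hgen hω
    rw [hgen.isMLE_iff] at hω
    have hn0 : 0 < √(n : ℝ) := Real.sqrt_pos.2 (by exact_mod_cast (by omega : 0 < n))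
    have hn1 : (n : ℝ) = √(n : ℝ) * √(n : ℝ) := (Real.mul_self_sqrt (Nat.cast_nonneg n)).symm
    ext i
    have h := hgen.mle_sub (δ := δ) (μ := μ) hα' hβ (pow_pos hσ 2) i
    simp only [g, PiLp.smul_apply, PiLp.sub_apply, smul_eq_mul]
    rw [hω, h, Finset.mul_sum]
    refine Finset.sum_congr rfl fun j _ => ?_
    rw [meanScore, sampleMean_sample]
    simp only [WithLp.ofLp_sum, Finset.sum_apply]
    nth_rewrite 3 [hn1]
    field_simp
  -- The sandwich covariance `I⁻¹ I (I⁻¹)ᵀ` collapses to `I⁻¹` by symmetry.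
  · have := map_mulVec_multivariateGaussian (posDef_fisherMatrix hα hβ hσ).posSemidef
      (asymptoticCov α β σ)
    rw [asymptoticCov_mul_fisherMatrix hα hβ hσ, one_mul] at this
    have ht : (asymptoticCov α β σ).transpose = asymptoticCov α β σ := by
      have := (posSemidef_asymptoticCov hα hβ hσ).isHermitian
      rwa [Matrix.IsHermitian, Matrix.conjTranspose_eq_transpose_of_trivial] at this
    rw [ht] at this
    exact this

/-! ### The three blocks -/

/-- The vector with the given blocks. -/
noncomputable def joinBlocks
    (p : EuclideanSpace ℝ (Fin 2) × (EuclideanSpace ℝ (Fin 2) × ℝ)) : EuclideanSpace ℝ (Fin 5) :=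
  !₂[p.1 0, p.1 1, p.2.1 0, p.2.1 1, p.2.2]

/-- The blocks of a vector. -/
noncomputable def splitBlocks (v : EuclideanSpace ℝ (Fin 5)) :
    EuclideanSpace ℝ (Fin 2) × (EuclideanSpace ℝ (Fin 2) × ℝ) :=
  (!₂[v 0, v 1], !₂[v 2, v 3], v 4)

lemma splitBlocks_joinBlocks
    (p : EuclideanSpace ℝ (Fin 2) × (EuclideanSpace ℝ (Fin 2) × ℝ)) :
    splitBlocks (joinBlocks p) = p := by
  refine Prod.ext ?_ (Prod.ext ?_ rfl)
  · ext i
    fin_cases i <;> rfl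
  · ext i
    fin_cases i <;> rfl

lemma continuous_splitBlocks : Continuous splitBlocks := by
  refine Continuous.prodMk ?_ (Continuous.prodMk ?_ (by fun_prop))
  · refine (PiLp.continuous_toLp 2 _).comp (continuous_pi fun i => ?_)
    fin_cases i <;> simp <;> fun_prop
  · refine (PiLp.continuous_toLp 2 _).comp (continuous_pi fun i => ?_)
    fin_cases i <;> simp <;> fun_prop

lemma continuous_joinBlocks : Continuous joinBlocks := by
  refine (PiLp.continuous_toLp 2 _).comp (continuous_pi fun i => ?_)
  fin_cases i <;> simp <;> fun_prop

/-- The characteristic function of a product law factors, and the quadratic form of a block-diagonal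
covariance is the sum of those of its blocks. -/
lemma map_joinBlocks (hα : 1 < α) (hβ : 0 < β) (hσ : 0 < σ) :
    ((multivariateGaussian 0 (covAlphaBeta α β)).prod
      ((multivariateGaussian 0 (covDeltaMu α β σ)).prod
        (gaussianReal 0 (2 * σ ^ 4).toNNReal))).map joinBlocks =
      multivariateGaussian 0 (asymptoticCov α β σ) := by
  have hα' : 0 < α := by linarith
  have := Measure.isProbabilityMeasure_map (μ := ((multivariateGaussian 0 (covAlphaBeta α β)).prod
      ((multivariateGaussian 0 (covDeltaMu α β σ)).prod
        (gaussianReal 0 (2 * σ ^ 4).toNNReal)))) continuous_joinBlocks.aemeasurable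
  refine Measure.ext_of_charFun (funext fun t => ?_)
  have e : ∀ p, Complex.exp (inner ℝ (joinBlocks p) t * Complex.I) =
      Complex.exp (inner ℝ p.1 !₂[t 0, t 1] * Complex.I) *
      (Complex.exp (inner ℝ p.2.1 !₂[t 2, t 3] * Complex.I) *
        Complex.exp (inner ℝ p.2.2 (t 4) * Complex.I)) := by
    intro p
    rw [← Complex.exp_add, ← Complex.exp_add]
    congr 1
    simp [joinBlocks, PiLp.inner_apply, Fin.sum_univ_five]
    ring
  rw [charFun_apply, integral_map continuous_joinBlocks.aemeasurable (by fun_prop)]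
  simp_rw [e]
  rw [integral_prod_mul (fun x => Complex.exp (inner ℝ x !₂[t 0, t 1] * Complex.I))
    (fun y : EuclideanSpace ℝ (Fin 2) × ℝ => Complex.exp (inner ℝ y.1 !₂[t 2, t 3] * Complex.I) *
        Complex.exp (inner ℝ y.2 (t 4) * Complex.I)),
    integral_prod_mul (fun x => Complex.exp (inner ℝ x !₂[t 2, t 3] * Complex.I))
    (fun y : ℝ => Complex.exp (inner ℝ y (t 4) * Complex.I)),
    ← charFun_apply, ← charFun_apply, ← charFun_apply,
    charFun_multivariateGaussian (posDef_covAlphaBeta hα' hβ).posSemidef,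
    charFun_multivariateGaussian (posDef_covDeltaMu hα hβ hσ).posSemidef, charFun_gaussianReal,
    charFun_multivariateGaussian (posSemidef_asymptoticCov hα hβ hσ), ← Complex.exp_add,
    ← Complex.exp_add, Real.coe_toNNReal _ (by positivity)]
  congr 1
  simp [dotProduct, Matrix.mulVec, Fin.sum_univ_five, asymptoticCov]
  ring

lemma map_splitBlocks (hα : 1 < α) (hβ : 0 < β) (hσ : 0 < σ) :
    (multivariateGaussian 0 (asymptoticCov α β σ)).map splitBlocks =
      (multivariateGaussian 0 (covAlphaBeta α β)).prod
        ((multivariateGaussian 0 (covDeltaMu α β σ)).prod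
          (gaussianReal 0 (2 * σ ^ 4).toNNReal)) := by
  rw [← map_joinBlocks hα hβ hσ, Measure.map_map continuous_splitBlocks.measurable
    continuous_joinBlocks.measurable]
  have : splitBlocks ∘ joinBlocks = id := funext splitBlocks_joinBlocks
  rw [this, Measure.map_id]

end convergence

end BGGL

/-! ### The main theorem. -/

theorem theorem4p1 {Ω : Type*} [MeasurableSpace Ω] (P : Measure Ω) [IsProbabilityMeasure P]
    (α β δ μ σ : ℝ) (hα : 1 < α) (hβ : 0 < β) (hσ : 0 < σ)
    (θ : EuclideanSpace ℝ (Fin 5)) (hθ : θ = !₂[α, β, δ, μ, σ ^ 2])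
    (X Y : ℕ → Ω → ℝ)
    (hlaw : ∀ i, HasLaw (fun ω => (X i ω, Y i ω)) (BGGL.law α β δ μ σ) P)
    (hindep : iIndepFun (fun i ω => (X i ω, Y i ω)) P) :
    -- the Fisher information matrix is finite, given by the block-diagonal formula, and regular
    MemLp (BGGL.score θ) 2 (BGGL.law α β δ μ σ) ∧
    BGGL.fisherInfo θ =
      !![BGGL.trigamma α, -1 / β, 0, 0, 0;
         -1 / β, α / β ^ 2, 0, 0, 0;
         0, 0, β / ((α - 1) * σ ^ 2), 1 / σ ^ 2, 0;
         0, 0, 1 / σ ^ 2, α / (β * σ ^ 2), 0;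
         0, 0, 0, 0, 1 / (2 * σ ^ 4)] ∧
    (BGGL.fisherInfo θ).PosDef ∧
    BGGL.covAlphaBeta α β = (BGGL.gammaFisher α β)⁻¹ ∧
    (BGGL.covAlphaBeta α β).PosDef ∧ (BGGL.covDeltaMu α β σ).PosDef ∧
    -- almost surely the maximum likelihood estimate exists and is unique,
    -- and it is a measurable function of the sample
    (∃ T : (n : ℕ) → (Fin n → ℝ × ℝ) → EuclideanSpace ℝ (Fin 5),
      (∀ n, Measurable (T n)) ∧
      ∀ n, 3 ≤ n → ∀ᵐ ω ∂P, ∀ θ' : EuclideanSpace ℝ (Fin 5),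
        BGGL.IsMLE (fun i : Fin n => (X i ω, Y i ω)) θ' ↔
          θ' = T n (fun i : Fin n => (X i ω, Y i ω))) ∧
    -- every maximum likelihood estimator is asymptotically normal
    ∀ θhat : ℕ → Ω → EuclideanSpace ℝ (Fin 5),
      (∀ n, AEMeasurable (θhat n) P) →
      (∀ n, 3 ≤ n → ∀ᵐ ω ∂P, BGGL.IsMLE (fun i : Fin n => (X i ω, Y i ω)) (θhat n ω)) →
      TendstoInDistribution (fun (n : ℕ) ω => √(n : ℝ) • (θhat n ω - θ)) atTop id (fun _ => P)
        (multivariateGaussian 0 (BGGL.fisherInfo θ)⁻¹) ∧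
      -- asymptotic independence of the three blocks, with explicit limits
      TendstoInDistribution
        (fun (n : ℕ) ω =>
          (√(n : ℝ) • !₂[θhat n ω 0 - α, θhat n ω 1 - β],
            √(n : ℝ) • !₂[θhat n ω 2 - δ, θhat n ω 3 - μ],
            √(n : ℝ) * (θhat n ω 4 - σ ^ 2)))
        atTop id (fun _ => P)
        ((multivariateGaussian 0 (BGGL.covAlphaBeta α β)).prod
          ((multivariateGaussian 0 (BGGL.covDeltaMu α β σ)).prod
            (gaussianReal 0 (2 * σ ^ 4).toNNReal))) ∧
      TendstoInDistribution
        (fun (n : ℕ) ω => √(n : ℝ) • !₂[θhat n ω 0 - α, θhat n ω 1 - β]) atTop id (fun _ => P)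
        (multivariateGaussian 0 (BGGL.covAlphaBeta α β)) ∧
      TendstoInDistribution
        (fun (n : ℕ) ω => √(n : ℝ) • !₂[θhat n ω 2 - δ, θhat n ω 3 - μ]) atTop id (fun _ => P)
        (multivariateGaussian 0 (BGGL.covDeltaMu α β σ)) ∧
      TendstoInDistribution
        (fun (n : ℕ) ω => √(n : ℝ) * (θhat n ω 4 - σ ^ 2)) atTop id (fun _ => P)
        (gaussianReal 0 (2 * σ ^ 4).toNNReal) := by

  have hα' : 0 < α := by linarith
  subst hθ
  rw [BGGL.fisherInfo_eq hα hβ hσ]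
  refine ⟨BGGL.memLp_score hα hβ hσ, rfl, BGGL.posDef_fisherMatrix hα hβ hσ,
    BGGL.covAlphaBeta_eq_inv hα' hβ, BGGL.posDef_covAlphaBeta hα' hβ,
    BGGL.posDef_covDeltaMu hα hβ hσ, ⟨fun n => BGGL.mle, fun n => BGGL.measurable_mle, ?_⟩, ?_⟩
  · intro n hn
    filter_upwards [BGGL.generic_ae hα' hβ hσ hlaw hindep hn] with ω hω θ'
    exact hω.isMLE_iff θ'
  intro θhat hmeas hmle
  rw [BGGL.fisherMatrix_inv hα hβ hσ]
  have h := BGGL.tendstoInDistribution_mle hα hβ hσ hlaw hindep hmeas hmle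
  have hb : TendstoInDistribution
      (fun (n : ℕ) ω =>
        (√(n : ℝ) • !₂[θhat n ω 0 - α, θhat n ω 1 - β],
          √(n : ℝ) • !₂[θhat n ω 2 - δ, θhat n ω 3 - μ],
          √(n : ℝ) * (θhat n ω 4 - σ ^ 2)))
      atTop id (fun _ => P)
      ((multivariateGaussian 0 (BGGL.covAlphaBeta α β)).prod
        ((multivariateGaussian 0 (BGGL.covDeltaMu α β σ)).prod
          (gaussianReal 0 (2 * σ ^ 4).toNNReal))) := by
    -- Continuous mapping along the splitting into blocks, under which the limit law becomes a
    -- product; the marginal statements then follow by projection.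
    have h1 := BGGL.TendstoInDistribution.of_map_eq
      (h.continuous_comp BGGL.continuous_splitBlocks) (BGGL.map_splitBlocks hα hβ hσ)
    convert! h1 using 3 with n ω
    refine Prod.ext ?_ (Prod.ext ?_ ?_)
    · ext i
      fin_cases i <;> simp [BGGL.splitBlocks]
    · ext i
      fin_cases i <;> simp [BGGL.splitBlocks]
    · simp [BGGL.splitBlocks]
  have hc1 := hb.continuous_comp continuous_fst
  have hc2 := hb.continuous_comp (continuous_fst.comp continuous_snd)
  have hc3 := hb.continuous_comp (continuous_snd.comp continuous_snd)
  exact ⟨h, hb, BGGL.TendstoInDistribution.of_map_eq hc1 measurePreserving_fst.map_eq,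
    BGGL.TendstoInDistribution.of_map_eq hc2
      (measurePreserving_fst.comp measurePreserving_snd).map_eq,
    BGGL.TendstoInDistribution.of_map_eq hc3
      (measurePreserving_snd.comp measurePreserving_snd).map_eq⟩
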